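/- Let $k$ be an arbitrary field and let $p,q\in k$ satisfy $p^2=q^2+q^3$. Let $\tilde A$ be the Hopf algebra over $k$ generated as an algebra by $a,b,x,y$ subject to the relations $$ba=ab,\quad ya=ay,\quad bx=xb,\quad yx=xy,\quad by=-yb,\quad y^2=x^2+x^3,\quad b^2=a^3=1,$$ $$a^2x+axa+xa^2+a^2-a^3=0,\qquad x^2a+xax+ax^2+xa+ax=0,$$ with $\Delta(a)=a\otimes a$, $\Delta(b)=b\otimes b$, $\Delta(x)=1\otimes x+x\otimes a$, $\Delta(y)=1\otimes y+y\otimes b$. Let $$c:=(xa)^3+2a(xa)^2x+a(xa)^2-3a^2(xa)x^2-2a^2(xa)x-(xa)x+ax^2+ax-2x^2-2x\in\tilde A,$$ which is a central primitive element, and let $A:=\tilde A/\tilde A c$ be the quotient Hopf algebra. Let $B\subset A$ be the subalgebra generated by $x+qa$ and $y+pb$, let $B^+:=B\cap\ker\varepsilon$, and let $\pi\colon A\to A/AB^+$ be the canonical projection, $[z]:=\pi(z)$. Then: 1. $B$ is a right coideal of $A$, i.e. $\Delta(B)\subseteq B\otimes A$. 2. $AB^+$ is a coideal of $A$ (so that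 $A/AB^+$ is a quotient coalgebra of $A$), the elements $[a^ib^j(xa)^l]$ with $i,l\in\{0,1,2\}$, $j\in\{0,1\}$ form a $k$-linear basis of $A/AB^+$, and the linear map $\gamma\colon A/AB^+\to A$ given by $$\gamma([a^ib^j])=a^ib^j,\qquad \gamma([a^ib^jxa])=a^ib^jxa,\qquad \gamma([a^ib^j(xa)^2])=a^ib^j\bigl((xa)^2-axa(x+qa-q)\bigr)$$ is a splitting of $\pi$ (that is, $\pi\circ\gamma=\mathrm{id}$) and a cleaving map: it is left $A/AB^+$-colinear, i.e. $(\pi\otimes\mathrm{id})\circ\Delta\circ\gamma=(\mathrm{id}\otimes\gamma)\circ\Delta_{A/AB^+}$, and it is invertible for the convolution product of $\mathrm{Hom}_k(A/AB^+,A)$. 3. Hence the extension $B\subset A$ is cleft: $B$ is a right coideal subalgebra, $B=\{z\in A\mid(\pi\otimes\mathrm{id})\Delta(z)=\pi(1)\otimes z\}$ is the algebra of left $A/AB^+$-coinvariants, and there exists a cleaving map $A/AB^+\to A$. -/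

import Mathlib

set_option linter.unusedSimpArgs false

open scoped TensorProduct

/-! ### Right coideal subalgebras and cleaving maps -/

noncomputable section

namespace HopfCleft

open Coalgebra

variable {k A : Type*} [Field k] [Ring A] [HopfAlgebra k A]

/-- `B` is a right coideal: `Δ(B) ⊆ B ⊗ A`, as a subspace of `A ⊗ A`. -/
def IsRightCoideal (B : Subalgebra k A) : Prop :=
  ∀ z ∈ B, (comul z : A ⊗[k] A) ∈
    LinearMap.range ((Subalgebra.toSubmodule B).subtype.rTensor A)

/-- The left ideal `A B⁺` of `A`, where `B⁺ = B ∩ ker ε`, as a `k`-subspace of `A`. -/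
def leftIdealPlus (B : Subalgebra k A) : Submodule k A :=
  (Ideal.span {z : A | z ∈ B ∧ counit (R := k) z = 0}).restrictScalars k

/-- The left coaction `(π ⊗ id) ∘ Δ : A → A/AB⁺ ⊗ A`, where `π : A → A/AB⁺` is the canonical
projection. -/
def leftCoaction (B : Subalgebra k A) : A →ₗ[k] (A ⧸ leftIdealPlus B) ⊗[k] A :=
  (leftIdealPlus B).mkQ.rTensor A ∘ₗ comul

/-- A cleaving map `γ : A/AB⁺ → A`: a left `A/AB⁺`-colinear map which is invertible for the
convolution product of `Hom(A/AB⁺, A)`. The quotient `A/AB⁺` carries its quotient coalgebra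
structure, and the left coaction on itself is its comultiplication. -/
structure IsCleavingMap (B : Subalgebra k A) [(leftIdealPlus B).IsCoideal]
    (γ : (A ⧸ leftIdealPlus B) →ₗ[k] A) : Prop where
  colinear : leftCoaction B ∘ₗ γ = γ.lTensor (A ⧸ leftIdealPlus B) ∘ₗ comul
  convolution_invertible : IsUnit (WithConv.toConv γ)

/-- The extension `B ⊆ A` is cleft: `B` is a right coideal subalgebra, it is the algebra of left
`A/AB⁺`-coinvariants of `A`, and there is a cleaving map `A/AB⁺ → A`. -/
def IsCleft (B : Subalgebra k A) : Prop :=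
  IsRightCoideal B ∧
  (∀ z : A, z ∈ B ↔ leftCoaction B z = (leftIdealPlus B).mkQ 1 ⊗ₜ[k] z) ∧
  ∃ _ : (leftIdealPlus B).IsCoideal, ∃ γ : (A ⧸ leftIdealPlus B) →ₗ[k] A, IsCleavingMap B γ

end HopfCleft

/-! ### The Hopf algebra `Ã` -/

namespace NodalCubic

open Coalgebra

/-- Names of the four generators. -/
inductive Gen
  | a
  | b
  | x
  | y

/-- The defining relations of `Ã`, for four elements of a ring: the relations of the universal
Hopf algebra coacting on the nodal cubic, together with `a ^ 3 = 1`. -/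
structure Relations {R : Type*} [Ring R] (a b x y : R) : Prop where
  ba : b * a = a * b
  ya : y * a = a * y
  bx : b * x = x * b
  yx : y * x = x * y
  by_ : b * y = -(y * b)
  cubic₁ : a ^ 2 * x + a * x * a + x * a ^ 2 + a ^ 2 - a ^ 3 = 0
  cubic₂ : x ^ 2 * a + x * a * x + a * x ^ 2 + x * a + a * x = 0
  yy : y ^ 2 = x ^ 2 + x ^ 3
  bb : b ^ 2 = a ^ 3
  aaa : a ^ 3 = 1

section Free

variable (k : Type*) [Field k]

local notation "𝐚" => FreeAlgebra.ι k Gen.a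
local notation "𝐛" => FreeAlgebra.ι k Gen.b
local notation "𝐱" => FreeAlgebra.ι k Gen.x
local notation "𝐲" => FreeAlgebra.ι k Gen.y

/-- The same relations, as a relation on the free algebra on the four generators. -/
inductive Rel : FreeAlgebra k Gen → FreeAlgebra k Gen → Prop
  | ba : Rel (𝐛 * 𝐚) (𝐚 * 𝐛)
  | ya : Rel (𝐲 * 𝐚) (𝐚 * 𝐲)
  | bx : Rel (𝐛 * 𝐱) (𝐱 * 𝐛)
  | yx : Rel (𝐲 * 𝐱) (𝐱 * 𝐲)
  | by_ : Rel (𝐛 * 𝐲) (-(𝐲 * 𝐛))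
  | cubic₁ : Rel (𝐚 ^ 2 * 𝐱 + 𝐚 * 𝐱 * 𝐚 + 𝐱 * 𝐚 ^ 2 + 𝐚 ^ 2 - 𝐚 ^ 3) 0
  | cubic₂ : Rel (𝐱 ^ 2 * 𝐚 + 𝐱 * 𝐚 * 𝐱 + 𝐚 * 𝐱 ^ 2 + 𝐱 * 𝐚 + 𝐚 * 𝐱) 0
  | yy : Rel (𝐲 ^ 2) (𝐱 ^ 2 + 𝐱 ^ 3)
  | bb : Rel (𝐛 ^ 2) (𝐚 ^ 3)
  | aaa : Rel (𝐚 ^ 3) 1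

end Free

/-- The algebra `Ã` over `k` generated by `a, b, x, y` subject to the relations. -/
def Tilde (k : Type*) [Field k] : Type _ := RingQuot (Rel k)

namespace Tilde

section

variable (k : Type*) [Field k]

instance : Ring (Tilde k) := inferInstanceAs (Ring (RingQuot (Rel k)))

instance : Algebra k (Tilde k) := inferInstanceAs (Algebra k (RingQuot (Rel k)))

/-- The class of a noncommutative polynomial in the generators. -/
def mk : FreeAlgebra k Gen →ₐ[k] Tilde k := RingQuot.mkAlgHom k (Rel k)

/-- The generator `a` of `Ã`. -/
def a : Tilde k := mk k (FreeAlgebra.ι k Gen.a)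

/-- The generator `b` of `Ã`. -/
def b : Tilde k := mk k (FreeAlgebra.ι k Gen.b)

/-- The generator `x` of `Ã`. -/
def x : Tilde k := mk k (FreeAlgebra.ι k Gen.x)

/-- The generator `y` of `Ã`. -/
def y : Tilde k := mk k (FreeAlgebra.ι k Gen.y)

theorem mk_rel {u v : FreeAlgebra k Gen} (h : Rel k u v) : mk k u = mk k v :=
  RingQuot.mkAlgHom_rel k h

theorem relations : Relations (a k) (b k) (x k) (y k) where
  ba := by simpa [a, b, x, y] using mk_rel k Rel.ba
  ya := by simpa [a, b, x, y] using mk_rel k Rel.ya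
  bx := by simpa [a, b, x, y] using mk_rel k Rel.bx
  yx := by simpa [a, b, x, y] using mk_rel k Rel.yx
  by_ := by simpa [a, b, x, y] using mk_rel k Rel.by_
  cubic₁ := by simpa only [a, b, x, y, map_mul, map_add, map_sub, map_pow, map_zero]
    using mk_rel k Rel.cubic₁
  cubic₂ := by simpa only [a, b, x, y, map_mul, map_add, map_sub, map_pow, map_zero]
    using mk_rel k Rel.cubic₂
  yy := by simpa [a, b, x, y] using mk_rel k Rel.yy
  bb := by simpa [a, b, x, y] using mk_rel k Rel.bb
  aaa := by simpa [a, b, x, y] using mk_rel k Rel.aaa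

end

variable {k : Type*} [Field k]

/-- Algebra homomorphisms out of `Ã` are given by quadruples satisfying the relations. -/
def lift {R : Type*} [Ring R] [Algebra k R] {a' b' x' y' : R} (h : Relations a' b' x' y') :
    Tilde k →ₐ[k] R :=
  RingQuot.liftAlgHom k ⟨FreeAlgebra.lift k (fun g => match g with
    | Gen.a => a'
    | Gen.b => b'
    | Gen.x => x'
    | Gen.y => y'), by
    intro u v huv
    induction huv
    · simpa using h.ba
    · simpa using h.ya
    · simpa using h.bx
    · simpa using h.yx
    · simpa using h.by_
    · simpa using h.cubic₁
    · simpa using h.cubic₂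
    · simpa using h.yy
    · simpa using h.bb
    · simpa using h.aaa⟩

section

variable {R : Type*} [Ring R] [Algebra k R] {a' b' x' y' : R} (h : Relations a' b' x' y')

@[simp] theorem lift_a : lift (k := k) h (a k) = a' := by
  exact (RingQuot.liftAlgHom_mkAlgHom_apply k _ _ _).trans (FreeAlgebra.lift_ι_apply _ _)

@[simp] theorem lift_b : lift (k := k) h (b k) = b' := by
  exact (RingQuot.liftAlgHom_mkAlgHom_apply k _ _ _).trans (FreeAlgebra.lift_ι_apply _ _)

@[simp] theorem lift_x : lift (k := k) h (x k) = x' := by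
  exact (RingQuot.liftAlgHom_mkAlgHom_apply k _ _ _).trans (FreeAlgebra.lift_ι_apply _ _)

@[simp] theorem lift_y : lift (k := k) h (y k) = y' := by
  exact (RingQuot.liftAlgHom_mkAlgHom_apply k _ _ _).trans (FreeAlgebra.lift_ι_apply _ _)

end

@[ext] theorem algHom_ext {R : Type*} [Semiring R] [Algebra k R] {f g : Tilde k →ₐ[k] R}
    (ha : f (a k) = g (a k)) (hb : f (b k) = g (b k)) (hx : f (x k) = g (x k))
    (hy : f (y k) = g (y k)) : f = g := by
  refine RingQuot.ringQuot_ext' k f g (FreeAlgebra.hom_ext (funext fun i => ?_))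
  cases i
  · exact ha
  · exact hb
  · exact hx
  · exact hy

/-- Induction over the generators. -/
theorem induction {P : Tilde k → Prop} (hr : ∀ r : k, P (algebraMap k _ r))
    (ha : P (a k)) (hb : P (b k)) (hx : P (x k)) (hy : P (y k))
    (hadd : ∀ u v, P u → P v → P (u + v)) (hmul : ∀ u v, P u → P v → P (u * v))
    (z : Tilde k) : P z := by
  obtain ⟨w, rfl⟩ := RingQuot.mkAlgHom_surjective k (Rel k) z
  change P (mk k w)
  induction w using FreeAlgebra.induction with
  | grade0 r => rw [AlgHom.commutes]; exact hr r
  | grade1 i =>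
    cases i
    · exact ha
    · exact hb
    · exact hx
    · exact hy
  | mul u v hu hv => rw [map_mul]; exact hmul _ _ hu hv
  | add u v hu hv => rw [map_add]; exact hadd _ _ hu hv

/-! #### A complete system of reduction rules, in right-associated form -/

section rules

theorem ab : a k * b k = b k * a k := (relations k).ba.symm
theorem xb : x k * b k = b k * x k := (relations k).bx.symm
theorem yb : y k * b k = -(b k * y k) := by rw [(relations k).by_, neg_neg]
theorem ya : y k * a k = a k * y k := (relations k).ya
theorem yx : y k * x k = x k * y k := (relations k).yx
theorem aaa : a k * (a k * a k) = 1 := by rw [← (relations k).aaa]; noncomm_ring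
theorem bb : b k * b k = 1 := by rw [← (relations k).aaa, ← (relations k).bb]; noncomm_ring
theorem xaa : x k * (a k * a k) =
    -(a k * (x k * a k)) - a k * (a k * x k) - a k * a k + 1 := by
  have h := (relations k).cubic₁
  rw [(relations k).aaa] at h
  rw [← sub_eq_zero, ← h]; noncomm_ring
theorem xxa : x k * (x k * a k) =
    -(x k * (a k * x k)) - a k * (x k * x k) - x k * a k - a k * x k := by
  rw [← sub_eq_zero, ← (relations k).cubic₂]; noncomm_ring
theorem xxx : x k * (x k * x k) = y k * y k - x k * x k := by
  have h : y k * y k = x k ^ 2 + x k ^ 3 := by rw [← (relations k).yy]; noncomm_ring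
  rw [h]; noncomm_ring

variable (w : Tilde k)

theorem ab_assoc : a k * (b k * w) = b k * (a k * w) := by rw [← mul_assoc, ab, mul_assoc]
theorem xb_assoc : x k * (b k * w) = b k * (x k * w) := by rw [← mul_assoc, xb, mul_assoc]
theorem yb_assoc : y k * (b k * w) = -(b k * (y k * w)) := by
  rw [← mul_assoc, yb, neg_mul, mul_assoc]
theorem ya_assoc : y k * (a k * w) = a k * (y k * w) := by rw [← mul_assoc, ya, mul_assoc]
theorem yx_assoc : y k * (x k * w) = x k * (y k * w) := by rw [← mul_assoc, yx, mul_assoc]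
theorem aaa_assoc : a k * (a k * (a k * w)) = w := by
  rw [← mul_assoc (a k) (a k) w, ← mul_assoc, aaa, one_mul]
theorem bb_assoc : b k * (b k * w) = w := by rw [← mul_assoc, bb, one_mul]
theorem xaa_assoc : x k * (a k * (a k * w)) =
    -(a k * (x k * (a k * w))) - a k * (a k * (x k * w)) - a k * (a k * w) + w := by
  have h := congrArg (· * w) (xaa (k := k))
  simpa only [mul_assoc, add_mul, sub_mul, neg_mul, one_mul] using h
theorem xxa_assoc : x k * (x k * (a k * w)) =
    -(x k * (a k * (x k * w))) - a k * (x k * (x k * w)) - x k * (a k * w)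
      - a k * (x k * w) := by
  have h := congrArg (· * w) (xxa (k := k))
  simpa only [mul_assoc, add_mul, sub_mul, neg_mul, one_mul] using h
theorem xxx_assoc : x k * (x k * (x k * w)) = y k * (y k * w) - x k * (x k * w) := by
  have h := congrArg (· * w) (xxx (k := k))
  simpa only [mul_assoc, add_mul, sub_mul, neg_mul, one_mul] using h

end rules

/-! #### The Hopf algebra structure -/

theorem relations_comul : Relations (R := Tilde k ⊗[k] Tilde k)
    (a k ⊗ₜ a k) (b k ⊗ₜ b k) (1 ⊗ₜ x k + x k ⊗ₜ a k) (1 ⊗ₜ y k + y k ⊗ₜ b k) := by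
  constructor <;>
  simp only [pow_succ, pow_zero, one_mul, mul_one, add_mul, mul_add,
    Algebra.TensorProduct.tmul_mul_tmul, mul_assoc, neg_mul, mul_neg, sub_mul, mul_sub,
    TensorProduct.tmul_add, TensorProduct.add_tmul, TensorProduct.tmul_neg,
    TensorProduct.neg_tmul, TensorProduct.tmul_sub, TensorProduct.sub_tmul,
    ab, xb, yb, ya, yx, aaa, bb, xaa, xxa, xxx, ab_assoc, xb_assoc, yb_assoc, ya_assoc,
    yx_assoc, aaa_assoc, bb_assoc, xaa_assoc, xxa_assoc, xxx_assoc,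
    Algebra.TensorProduct.one_def] <;>
  abel

theorem relations_counit : Relations (R := k) 1 1 0 0 := by
  constructor <;> simp

theorem relations_antipode : Relations (R := (Tilde k)ᵐᵒᵖ)
    (.op (a k ^ 2)) (.op (b k)) (.op (-(x k * a k ^ 2))) (.op (-(y k * b k))) := by
  constructor <;> apply MulOpposite.unop_injective <;>
  simp only [MulOpposite.unop_mul, MulOpposite.unop_add, MulOpposite.unop_sub,
    MulOpposite.unop_neg, MulOpposite.unop_pow, MulOpposite.unop_op, MulOpposite.unop_one,
    MulOpposite.unop_zero,
    pow_succ, pow_zero, one_mul, mul_one, add_mul, mul_add,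
    mul_assoc, neg_mul, mul_neg, sub_mul, mul_sub,
    ab, xb, yb, ya, yx, aaa, bb, xaa, xxa, xxx, ab_assoc, xb_assoc, yb_assoc, ya_assoc,
    yx_assoc, aaa_assoc, bb_assoc, xaa_assoc, xxa_assoc, xxx_assoc] <;>
  abel

/-- The bialgebra structure of `Ã`: `a` and `b` are group-like,
`Δ(x) = 1 ⊗ x + x ⊗ a` and `Δ(y) = 1 ⊗ y + y ⊗ b`. -/
instance : Bialgebra k (Tilde k) :=
  Bialgebra.ofAlgHom (lift relations_comul) (lift relations_counit)
    (by ext <;> simp [TensorProduct.tmul_add, TensorProduct.add_tmul,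
          Algebra.TensorProduct.one_def, add_assoc])
    (by ext <;> simp)
    (by ext <;> simp)

@[simp] theorem comul_a : comul (R := k) (a k) = a k ⊗ₜ a k := lift_a relations_comul
@[simp] theorem comul_b : comul (R := k) (b k) = b k ⊗ₜ b k := lift_b relations_comul
@[simp] theorem comul_x : comul (R := k) (x k) = 1 ⊗ₜ x k + x k ⊗ₜ a k := lift_x relations_comul
@[simp] theorem comul_y : comul (R := k) (y k) = 1 ⊗ₜ y k + y k ⊗ₜ b k := lift_y relations_comul
@[simp] theorem counit_a : counit (R := k) (a k) = 1 := lift_a relations_counit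
@[simp] theorem counit_b : counit (R := k) (b k) = 1 := lift_b relations_counit
@[simp] theorem counit_x : counit (R := k) (x k) = 0 := lift_x relations_counit
@[simp] theorem counit_y : counit (R := k) (y k) = 0 := lift_y relations_counit

/-- The antipode, as a linear map. -/
def anti : Tilde k →ₗ[k] Tilde k :=
  (MulOpposite.opLinearEquiv k).symm.toLinearMap ∘ₗ (lift relations_antipode).toLinearMap

theorem anti_apply (z : Tilde k) : anti z = (lift relations_antipode z).unop := rfl

theorem anti_mul (z w : Tilde k) : anti (z * w) = anti w * anti z := by
  simp [anti_apply]

/-- The Hopf algebra structure of `Ã`: the antipode is the anti-homomorphism with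
`S(a) = a²`, `S(b) = b`, `S(x) = - x a²` and `S(y) = - y b`. -/
instance : HopfAlgebra k (Tilde k) :=
  HopfAlgebra.ofConvInverse anti
    (by
      ext z
      rw [LinearMap.convOne_apply]
      induction z using Tilde.induction with
      | hr r => simp [Algebra.TensorProduct.one_def, anti_apply, Algebra.algebraMap_eq_smul_one]
      | ha => simp [anti_apply, pow_succ, mul_assoc, aaa]
      | hb => simp [anti_apply, bb]
      | hx => simp [anti_apply, pow_succ, mul_assoc, aaa]
      | hy => simp [anti_apply, mul_assoc, bb]
      | hadd u v hu hv => simp only [map_add]; rw [← hu, ← hv]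
      | hmul u v hu hv =>
        rw [(ℛ k u).convMul_apply] at hu
        rw [(ℛ k v).convMul_apply] at hv
        rw [((ℛ k u).mul (ℛ k v)).convMul_apply]
        have e : ∀ i ∈ (ℛ k v).index, ∑ j ∈ (ℛ k u).index,
            anti ((ℛ k u).left j * (ℛ k v).left i) * ((ℛ k u).right j * (ℛ k v).right i) =
            algebraMap k _ (counit (R := k) u) *
              (anti ((ℛ k v).left i) * (ℛ k v).right i) := by
          intro i _
          calc _ = anti ((ℛ k v).left i) * (∑ j ∈ (ℛ k u).index,
                anti ((ℛ k u).left j) * (ℛ k u).right j) * (ℛ k v).right i := by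
                simp only [Finset.mul_sum, Finset.sum_mul, anti_mul, mul_assoc]
            _ = _ := by
                have hu' : (∑ j ∈ (ℛ k u).index, anti ((ℛ k u).left j) * (ℛ k u).right j) =
                    algebraMap k _ (counit (R := k) u) := hu
                rw [hu', ← Algebra.commutes, mul_assoc]
        change ∑ i ∈ (ℛ k u).index ×ˢ (ℛ k v).index,
          anti ((ℛ k u).left i.1 * (ℛ k v).left i.2) *
            ((ℛ k u).right i.1 * (ℛ k v).right i.2) = _
        rw [Finset.sum_product_right, Finset.sum_congr rfl e, ← Finset.mul_sum,
          Bialgebra.counit_mul, map_mul, ← hv]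
        rfl)
    (by
      ext z
      rw [LinearMap.convOne_apply]
      induction z using Tilde.induction with
      | hr r => simp [Algebra.TensorProduct.one_def, anti_apply, Algebra.algebraMap_eq_smul_one]
      | ha => simp [anti_apply, pow_succ, mul_assoc, aaa]
      | hb => simp [anti_apply, bb]
      | hx => simp [anti_apply, pow_succ]
      | hy => simp [anti_apply]
      | hadd u v hu hv => simp only [map_add]; rw [← hu, ← hv]
      | hmul u v hu hv =>
        rw [(ℛ k u).convMul_apply] at hu
        rw [(ℛ k v).convMul_apply] at hv
        rw [((ℛ k u).mul (ℛ k v)).convMul_apply]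
        have e : ∀ i ∈ (ℛ k u).index, ∑ j ∈ (ℛ k v).index,
            ((ℛ k u).left i * (ℛ k v).left j) * anti ((ℛ k u).right i * (ℛ k v).right j) =
            ((ℛ k u).left i * anti ((ℛ k u).right i)) *
              algebraMap k _ (counit (R := k) v) := by
          intro i _
          calc _ = (ℛ k u).left i * (∑ j ∈ (ℛ k v).index,
                (ℛ k v).left j * anti ((ℛ k v).right j)) * anti ((ℛ k u).right i) := by
                simp only [Finset.mul_sum, Finset.sum_mul, anti_mul, mul_assoc]
            _ = _ := by
                have hv' : (∑ j ∈ (ℛ k v).index, (ℛ k v).left j * anti ((ℛ k v).right j)) =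
                    algebraMap k _ (counit (R := k) v) := hv
                rw [hv', mul_assoc, Algebra.commutes, mul_assoc]
        change ∑ i ∈ (ℛ k u).index ×ˢ (ℛ k v).index,
          ((ℛ k u).left i.1 * (ℛ k v).left i.2) *
            anti ((ℛ k u).right i.1 * (ℛ k v).right i.2) = _
        rw [Finset.sum_product, Finset.sum_congr rfl e, ← Finset.sum_mul,
          Bialgebra.counit_mul, map_mul, ← hu]
        rfl)

/-! #### The central primitive element `c` -/

/-- The element `c` of `Ã`. -/
def c (k : Type*) [Field k] : Tilde k :=
  (x k * a k) ^ 3 + 2 * a k * (x k * a k) ^ 2 * x k + a k * (x k * a k) ^ 2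
    - 3 * a k ^ 2 * (x k * a k) * x k ^ 2 - 2 * a k ^ 2 * (x k * a k) * x k
    - (x k * a k) * x k + a k * x k ^ 2 + a k * x k - 2 * x k ^ 2 - 2 * x k

theorem c_eq : c k =
    x k * (a k * (x k * (a k * (x k * a k))))
    + (a k * (x k * (a k * (x k * (a k * x k)))) + a k * (x k * (a k * (x k * (a k * x k)))))
    + a k * (x k * (a k * (x k * a k)))
    - (a k * (a k * (x k * (a k * (x k * x k)))) + a k * (a k * (x k * (a k * (x k * x k))))
      + a k * (a k * (x k * (a k * (x k * x k)))))
    - (a k * (a k * (x k * (a k * x k))) + a k * (a k * (x k * (a k * x k))))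
    - x k * (a k * x k) + a k * (x k * x k) + a k * x k - (x k * x k + x k * x k)
    - (x k + x k) := by
  unfold c
  noncomm_ring

theorem c_comm_a : c k * a k = a k * c k := by
  simp only [c_eq, add_mul, mul_add, mul_assoc, neg_mul, mul_neg, sub_mul, mul_sub, one_mul,
    mul_one, ab, xb, yb, ya, yx, aaa, bb, xaa, xxa, xxx, ab_assoc, xb_assoc, yb_assoc,
    ya_assoc, yx_assoc, aaa_assoc, bb_assoc, xaa_assoc, xxa_assoc, xxx_assoc]
  abel

theorem c_comm_b : c k * b k = b k * c k := by
  simp only [c_eq, add_mul, mul_add, mul_assoc, sub_mul, mul_sub, ab, xb, ab_assoc, xb_assoc]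

theorem c_comm_x : c k * x k = x k * c k := by
  simp only [c_eq, add_mul, mul_add, mul_assoc, neg_mul, mul_neg, sub_mul, mul_sub, one_mul,
    mul_one, ab, xb, yb, ya, yx, aaa, bb, xaa, xxa, xxx, ab_assoc, xb_assoc, yb_assoc,
    ya_assoc, yx_assoc, aaa_assoc, bb_assoc, xaa_assoc, xxa_assoc, xxx_assoc]
  abel

theorem c_comm_y : c k * y k = y k * c k := by
  simp only [c_eq, add_mul, mul_add, mul_assoc, sub_mul, mul_sub, ya, yx, ya_assoc, yx_assoc]

/-- The element `c` is central. -/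
theorem c_central (z : Tilde k) : c k * z = z * c k := by
  induction z using Tilde.induction with
  | hr r => exact (Algebra.commutes r _).symm
  | ha => exact c_comm_a
  | hb => exact c_comm_b
  | hx => exact c_comm_x
  | hy => exact c_comm_y
  | hadd u v hu hv => rw [mul_add, add_mul, hu, hv]
  | hmul u v hu hv => rw [← mul_assoc, hu, mul_assoc, hv, mul_assoc]

/-- The element `c` is primitive. -/
theorem comul_c : comul (R := k) (c k) = 1 ⊗ₜ c k + c k ⊗ₜ 1 := by
  simp only [c_eq, map_add, map_sub, Bialgebra.comul_mul, comul_a, comul_x]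
  simp only [one_mul, mul_one, add_mul, mul_add,
    Algebra.TensorProduct.tmul_mul_tmul, mul_assoc, neg_mul, mul_neg, sub_mul, mul_sub,
    TensorProduct.tmul_add, TensorProduct.add_tmul, TensorProduct.tmul_neg,
    TensorProduct.neg_tmul, TensorProduct.tmul_sub, TensorProduct.sub_tmul,
    ya, yx, aaa, xaa, xxa, xxx, ya_assoc,
    yx_assoc, aaa_assoc, xaa_assoc, xxa_assoc, xxx_assoc,
    Algebra.TensorProduct.one_def]
  abel

theorem counit_c : counit (R := k) (c k) = 0 := by
  simp [c_eq]

theorem antipode_c : HopfAlgebra.antipode k (c k) = -c k := by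
  have h := HopfAlgebra.mul_antipode_rTensor_comul_apply (R := k) (c k)
  rw [comul_c, counit_c] at h
  simp at h
  exact eq_neg_of_add_eq_zero_right h

/-- The ideal `Ã c` of `Ã`. -/
def idealC (k : Type*) [Field k] : Ideal (Tilde k) := Ideal.span {c k}

theorem mem_idealC {z : Tilde k} : z ∈ idealC k ↔ ∃ u, u * c k = z :=
  Ideal.mem_span_singleton'

instance : (idealC k).IsTwoSided :=
  ⟨fun {z} w hz => by
    obtain ⟨u, rfl⟩ := mem_idealC.1 hz
    exact mem_idealC.2 ⟨u * w, by rw [mul_assoc, ← c_central, mul_assoc]⟩⟩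

/-- The ideal `Ã c` is a Hopf ideal. -/
instance : (idealC k).IsHopfIdeal k where
  counit_eq_zero := by
    intro z hz
    obtain ⟨u, rfl⟩ := mem_idealC.1 hz
    rw [Bialgebra.counit_mul, counit_c, mul_zero]
  map_mkQ_comul_eq_zero := by
    intro z hz
    obtain ⟨u, rfl⟩ := mem_idealC.1 hz
    have hm : ∀ v : Tilde k, ((idealC k).restrictScalars k).mkQ (v * c k) = 0 := fun v =>
      (Submodule.Quotient.mk_eq_zero _).2 (mem_idealC.2 ⟨v, rfl⟩)
    rw [Bialgebra.comul_mul, comul_c, ← (ℛ k u).eq]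
    simp [Finset.sum_mul, mul_add, hm]
  antipode_mem := by
    intro z hz
    obtain ⟨u, rfl⟩ := mem_idealC.1 hz
    rw [HopfAlgebra.antipode_mul_antidistrib, antipode_c, neg_mul, c_central, ← neg_mul]
    exact mem_idealC.2 ⟨_, rfl⟩

end Tilde

/-! ### The Hopf algebra `A = Ã / Ãc` and its subalgebra `B` -/

/-- The Hopf algebra `A = Ã / Ãc`. Its Hopf algebra structure is the quotient structure. -/
abbrev A (k : Type*) [Field k] : Type _ := Tilde k ⧸ Tilde.idealC k

namespace A

variable (k : Type*) [Field k]

/-- The class of `a` in `A`. -/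
def a : A k := Ideal.Quotient.mk _ (Tilde.a k)

/-- The class of `b` in `A`. -/
def b : A k := Ideal.Quotient.mk _ (Tilde.b k)

/-- The class of `x` in `A`. -/
def x : A k := Ideal.Quotient.mk _ (Tilde.x k)

/-- The class of `y` in `A`. -/
def y : A k := Ideal.Quotient.mk _ (Tilde.y k)

end A

/-- The subalgebra `B` of `A` generated by `x + q a` and `y + p b`. -/
def B {k : Type*} [Field k] (p q : k) : Subalgebra k (A k) :=
  Algebra.adjoin k {A.x k + q • A.a k, A.y k + p • A.b k}

end NodalCubic

end

/-! ### General facts on right coideal subalgebras and cleaving maps -/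

namespace HopfCleft

open Coalgebra

variable {k A : Type*} [Field k] [Ring A] [HopfAlgebra k A]

/-! Put X = x + qa and Y = y + pb. Since Δ(X) = 1 ⊗ x + X ⊗ a and Δ(Y) = 1 ⊗ y + Y ⊗ b, the algebra
B is a right coideal. The left coaction of A/AB⁺ on A is then right B-linear (`leftCoaction_mul`),
which gives both that AB⁺ is a coideal and that elements of B are coinvariant.

The basis comes from two opposite bounds. The elements aⁱbʲ(xa)ˡ with l < 3 generate A as a right
B-module, because their right B-span contains 1 and is stable under left multiplication by the
generators (`rightSpan_eq_top`); the relation c = 0 is what expresses (xa)³ through lower terms.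
Modulo AB⁺ the algebra B acts on the right through ε, so the eighteen classes span. For
independence, A acts on k¹⁸ with a cyclic vector e₀ on which B acts by ε (`rep_of_mem`). Hence z ↦ z
e₀ factors through A/AB⁺, and it carries the eighteen classes to the standard basis.

The map γ and its convolution inverse δ are compatible with multiplication by the group generated by
a and b, so colinearity and invertibility need checking only on 1, xa and (xa)², where they are
finite computations.

Finally, if δ inverts γ, then z ↦ Σ δ([z₁]) z₂ sends γ(u)v to ε(u)v for v in B, hence maps A =
γ(A/AB⁺)B into B; on coinvariants it is the identity (`mem_of_coinvariant`). -/

theorem isRightCoideal_adjoin {s : Set A}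
    (hs : ∀ z ∈ s, (comul z : A ⊗[k] A) ∈ LinearMap.range
      ((Subalgebra.toSubmodule (Algebra.adjoin k s)).subtype.rTensor A)) :
    IsRightCoideal (Algebra.adjoin k s) := by
  set B := Algebra.adjoin k s
  -- The image of B ⊗ A in A ⊗ A is a subalgebra and Δ is multiplicative, so the condition need only
  -- be tested on generators.
  have key : B ≤ ((Algebra.TensorProduct.map B.val (AlgHom.id k A)).range).comap
      (Bialgebra.comulAlgHom k A) := by
    refine Algebra.adjoin_le fun z hz => ?_
    obtain ⟨t, ht⟩ := hs z hz
    exact ⟨t, ht⟩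
  intro z hz
  obtain ⟨t, ht⟩ := key hz
  exact ⟨t, ht⟩

/-- The difference v - ε(v) lies in B⁺, so B acts on the right of A/AB⁺ through the counit. -/
theorem mkQ_mul_of_mem {B : Subalgebra k A} (z : A) {v : A} (hv : v ∈ B) :
    (leftIdealPlus B).mkQ (z * v) = counit (R := k) v • (leftIdealPlus B).mkQ z := by
  rw [← map_smul, ← sub_eq_zero, ← map_sub]
  refine (Submodule.Quotient.mk_eq_zero _).2 ?_
  have e : z * v - counit (R := k) v • z = z * (v - algebraMap k A (counit v)) := by
    rw [mul_sub, ← Algebra.commutes, Algebra.smul_def]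
  rw [e]
  refine Ideal.mul_mem_left _ _ (Ideal.subset_span ⟨?_, ?_⟩)
  · exact sub_mem hv (B.algebraMap_mem _)
  · simp

theorem mkQ_mul_congr {B : Subalgebra k A} (g : A) {z w : A}
    (h : (leftIdealPlus B).mkQ z = (leftIdealPlus B).mkQ w) :
    (leftIdealPlus B).mkQ (g * z) = (leftIdealPlus B).mkQ (g * w) := by
  rw [← sub_eq_zero, ← map_sub] at h ⊢
  rw [← mul_sub]
  exact (Submodule.Quotient.mk_eq_zero _).2
    (Ideal.mul_mem_left _ g ((Submodule.Quotient.mk_eq_zero _).1 h))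

/-- The coaction is right `B`-linear. -/
theorem leftCoaction_mul {B : Subalgebra k A} (hB : IsRightCoideal B) (z : A) {v : A}
    (hv : v ∈ B) :
    leftCoaction B (z * v) =
      (LinearMap.mulRight k v).lTensor (A ⧸ leftIdealPlus B) (leftCoaction B z) := by
  obtain ⟨t, ht⟩ := hB v hv
  -- Writing v as Σ ε(v₁)v₂ makes both sides linear in a tensor t of B ⊗ A. On pure tensors the
  -- claim is [w₁v₁] ⊗ w₂v₂ = [w₁] ⊗ w₂ε(v₁)v₂.
  have hv' : v = TensorProduct.lid k A ((counit (R := k) (A := A)).rTensor A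
      ((Subalgebra.toSubmodule B).subtype.rTensor A t)) := by
    rw [ht, Coalgebra.rTensor_counit_comul]; simp
  have key : ∀ w : A ⊗[k] A, (leftIdealPlus B).mkQ.rTensor A
      (w * (Subalgebra.toSubmodule B).subtype.rTensor A t) =
      (LinearMap.mulRight k (TensorProduct.lid k A ((counit (R := k) (A := A)).rTensor A
        ((Subalgebra.toSubmodule B).subtype.rTensor A t)))).lTensor _
        ((leftIdealPlus B).mkQ.rTensor A w) := by
    intro w
    clear hv' ht
    induction t with
    | zero => simp [LinearMap.mulRight_eq_zero_iff]
    | add t₁ t₂ h₁ h₂ =>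
      have e : ∀ u₁ u₂ : A, LinearMap.mulRight k (u₁ + u₂) =
        LinearMap.mulRight k u₁ + LinearMap.mulRight k u₂ := fun u₁ u₂ => by
          ext; simp [mul_add]
      simp only [map_add, mul_add, h₁, h₂, e, LinearMap.lTensor_add, LinearMap.add_apply]
    | tmul v₁ v₂ =>
      induction w with
      | zero => simp
      | add w₁ w₂ h₁ h₂ => simp only [map_add, add_mul, h₁, h₂]
      | tmul w₁ w₂ =>
        simp only [LinearMap.rTensor_tmul, Submodule.subtype_apply,
          Algebra.TensorProduct.tmul_mul_tmul, LinearMap.lTensor_tmul, TensorProduct.lid_tmul,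
          LinearMap.mulRight_apply, mul_smul_comm, mkQ_mul_of_mem w₁ v₁.2,
          TensorProduct.smul_tmul]
  have := key (comul z)
  rw [← hv', ht, ← Bialgebra.comul_mul] at this
  exact this

theorem leftCoaction_of_mem {B : Subalgebra k A} (hB : IsRightCoideal B) {v : A} (hv : v ∈ B) :
    leftCoaction B v = (leftIdealPlus B).mkQ 1 ⊗ₜ[k] v := by
  have h := leftCoaction_mul hB 1 hv
  rw [one_mul] at h
  rw [h]
  simp [leftCoaction, Algebra.TensorProduct.one_def]

theorem leftIdealPlus_induction {B : Subalgebra k A} {P : A → Prop} (h0 : P 0)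
    (hadd : ∀ z w, P z → P w → P (z + w))
    (hmul : ∀ (z v : A), v ∈ B → counit (R := k) v = 0 → P (z * v))
    {z : A} (hz : z ∈ leftIdealPlus B) : P z := by
  have hz' : z ∈ Ideal.span {z : A | z ∈ B ∧ counit (R := k) z = 0} := hz
  refine Submodule.closure_induction (p := fun z _ => P z) h0 (fun z w _ _ => hadd z w) ?_ hz'
  rintro r v ⟨hv, hv0⟩
  exact hmul r v hv hv0

theorem isCoideal_leftIdealPlus {B : Subalgebra k A} (hB : IsRightCoideal B) :
    (leftIdealPlus B).IsCoideal where
  counit_eq_zero _ hz := by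
    refine leftIdealPlus_induction (P := fun z => counit (R := k) z = 0) (by simp)
      (fun z w h₁ h₂ => by simp [h₁, h₂]) (fun z v _ h => by simp [h]) hz
  map_mkQ_comul_eq_zero _ hz := by
    refine leftIdealPlus_induction (P := fun z => TensorProduct.map (leftIdealPlus B).mkQ
      (leftIdealPlus B).mkQ (comul z) = 0) (by simp)
      (fun z w h₁ h₂ => by simp only [map_add, h₁, h₂, add_zero]) (fun z v hv h => ?_) hz
    -- By B-linearity the coaction of zv is that of z followed by right multiplication by v in the
    -- second factor, and projecting that factor kills it because ε(v) = 0.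
    have e : (leftIdealPlus B).mkQ ∘ₗ LinearMap.mulRight k v = 0 := by
      ext w
      simp only [LinearMap.comp_apply, LinearMap.mulRight_apply, mkQ_mul_of_mem w hv, h,
        zero_smul, LinearMap.zero_apply]
    have h' := congrArg ((leftIdealPlus B).mkQ.lTensor _) (leftCoaction_mul hB z hv)
    rw [← LinearMap.comp_apply, ← LinearMap.comp_apply, ← LinearMap.lTensor_comp, e,
      LinearMap.lTensor_zero, LinearMap.zero_apply, leftCoaction, ← LinearMap.comp_assoc,
      LinearMap.lTensor_comp_rTensor] at h'
    exact h'

/-- If the right `B`-module generated by the image of a unital cleaving map is all of `A`, then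
`B` is the algebra of coinvariants. -/
theorem mem_of_coinvariant {B : Subalgebra k A} (hB : IsRightCoideal B)
    [(leftIdealPlus B).IsCoideal] {γ : (A ⧸ leftIdealPlus B) →ₗ[k] A} (hγ : IsCleavingMap B γ)
    (h1 : γ ((leftIdealPlus B).mkQ 1) = 1)
    (hspan : Submodule.span k {z : A | ∃ u, ∃ v ∈ B, z = γ u * v} = ⊤)
    {z : A} (hz : leftCoaction B z = (leftIdealPlus B).mkQ 1 ⊗ₜ[k] z) : z ∈ B := by
  obtain ⟨δ, hδ⟩ := hγ.convolution_invertible.exists_left_inv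
  -- Composed with the coaction, Φ is z ↦ Σ δ([z₁])z₂. Colinearity of γ turns its value at γ(u) into
  -- (δ * γ)(u) = ε(u).
  set Φ : (A ⧸ leftIdealPlus B) ⊗[k] A →ₗ[k] A := LinearMap.mul' k A ∘ₗ δ.ofConv.rTensor A
  have hΦγ : ∀ u, Φ (leftCoaction B (γ u)) = algebraMap k A (counit u) := by
    intro u
    have e := congrArg (fun f => f.ofConv u) hδ
    have e' := LinearMap.congr_fun hγ.colinear u
    rw [LinearMap.comp_apply, LinearMap.comp_apply] at e'
    rw [e']
    simp only [LinearMap.convMul_def, LinearMap.convOne_def] at e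
    rw [← LinearMap.comp_apply (f := LinearMap.lTensor _ _)]
    refine Eq.trans ?_ e
    simp only [Φ, LinearMap.comp_apply]
    congr 1
    rw [← LinearMap.comp_apply, LinearMap.rTensor_comp_lTensor]
  have hmul : ∀ (t : (A ⧸ leftIdealPlus B) ⊗[k] A) (v : A),
      Φ ((LinearMap.mulRight k v).lTensor _ t) = Φ t * v := by
    intro t v
    induction t with
    | zero => simp
    | add t₁ t₂ h₁ h₂ => simp only [map_add, add_mul, h₁, h₂]
    | tmul u w => simp [Φ, mul_assoc]
  have hmem : ∀ w : A, Φ (leftCoaction B w) ∈ B := by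
    intro w
    have hw : w ∈ Submodule.span k {z : A | ∃ u, ∃ v ∈ B, z = γ u * v} := hspan ▸ trivial
    induction hw using Submodule.span_induction with
    | mem w hw =>
      obtain ⟨u, v, hv, rfl⟩ := hw
      rw [leftCoaction_mul hB _ hv, hmul, hΦγ]
      exact mul_mem (B.algebraMap_mem _) hv
    | zero => simp
    | add w₁ w₂ _ _ h₁ h₂ => simpa only [map_add] using add_mem h₁ h₂
    | smul r w _ h => simpa only [map_smul] using B.smul_mem h r
  -- This normalisation follows from γ([1]) = 1; it makes Φ([1] ⊗ z) equal to z itself.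
  have hδ1 : δ.ofConv ((leftIdealPlus B).mkQ 1) = 1 := by
    have h := hΦγ ((leftIdealPlus B).mkQ 1)
    rw [h1, leftCoaction_of_mem hB (one_mem B)] at h
    simp only [Φ, LinearMap.comp_apply, LinearMap.rTensor_tmul, LinearMap.mul'_apply,
      mul_one] at h
    rw [h]
    simp
  have h := hmem z
  rw [hz] at h
  simpa only [Φ, LinearMap.comp_apply, LinearMap.rTensor_tmul, LinearMap.mul'_apply, hδ1,
    one_mul] using h

end HopfCleft

/-! ### Reduction rules in `A`, and `A` as a right `B`-module -/

namespace NodalCubic.A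

open HopfCleft

section rules

variable {k : Type*} [Field k]

theorem relations : Relations (a k) (b k) (x k) (y k) := by
  have h := Tilde.relations k
  have e : ∀ {u v : Tilde k}, u = v →
      Ideal.Quotient.mk (Tilde.idealC k) u = Ideal.Quotient.mk (Tilde.idealC k) v :=
    fun h => congrArg _ h
  constructor
  · simpa using! e h.ba
  · simpa using! e h.ya
  · simpa using! e h.bx
  · simpa using! e h.yx
  · simpa using! e h.by_
  · simpa using! e h.cubic₁
  · simpa using! e h.cubic₂
  · simpa using! e h.yy
  · simpa using! e h.bb
  · simpa using! e h.aaa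


theorem ab : a k * b k = b k * a k := relations.ba.symm
theorem xb : x k * b k = b k * x k := relations.bx.symm
theorem yb : y k * b k = -(b k * y k) := by rw [relations.by_, neg_neg]
theorem ya : y k * a k = a k * y k := relations.ya
theorem yx : y k * x k = x k * y k := relations.yx
theorem aaa : a k * (a k * a k) = 1 := by rw [← relations.aaa]; noncomm_ring
theorem bb : b k * b k = 1 := by rw [← relations.aaa, ← relations.bb]; noncomm_ring
theorem xaa : x k * (a k * a k) =
    -(a k * (x k * a k)) - a k * (a k * x k) - a k * a k + 1 := by
  have h := (relations (k := k)).cubic₁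
  rw [relations.aaa] at h
  rw [← sub_eq_zero, ← h]; noncomm_ring
theorem xxa : x k * (x k * a k) =
    -(x k * (a k * x k)) - a k * (x k * x k) - x k * a k - a k * x k := by
  rw [← sub_eq_zero, ← relations.cubic₂]; noncomm_ring
theorem xxx : x k * (x k * x k) = y k * y k - x k * x k := by
  have h : y k * y k = x k ^ 2 + x k ^ 3 := by rw [← relations.yy]; noncomm_ring
  rw [h]; noncomm_ring
-- This is c = 0 solved for (xa)³, the only rule not inherited from the relations of Ã. Multiples
-- are spelled as repeated sums to match `Tilde.c_eq`.
theorem xaxaxa : x k * (a k * (x k * (a k * (x k * a k)))) =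
    -(a k * (x k * (a k * (x k * (a k * x k)))) + a k * (x k * (a k * (x k * (a k * x k)))))
    - a k * (x k * (a k * (x k * a k)))
    + (a k * (a k * (x k * (a k * (x k * x k)))) + a k * (a k * (x k * (a k * (x k * x k))))
      + a k * (a k * (x k * (a k * (x k * x k)))))
    + (a k * (a k * (x k * (a k * x k))) + a k * (a k * (x k * (a k * x k))))
    + x k * (a k * x k) - a k * (x k * x k) - a k * x k + (x k * x k + x k * x k)
    + (x k + x k) := by
  have h : Ideal.Quotient.mk (Tilde.idealC k) (Tilde.c k) = 0 :=
    Ideal.Quotient.eq_zero_iff_mem.2 (Ideal.subset_span rfl)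
  rw [Tilde.c_eq] at h
  rw [← sub_eq_zero, ← h]
  simp only [map_add, map_sub, map_mul]
  change _ = x k * (a k * (x k * (a k * (x k * a k))))
    + (a k * (x k * (a k * (x k * (a k * x k)))) + a k * (x k * (a k * (x k * (a k * x k)))))
    + a k * (x k * (a k * (x k * a k)))
    - (a k * (a k * (x k * (a k * (x k * x k)))) + a k * (a k * (x k * (a k * (x k * x k))))
      + a k * (a k * (x k * (a k * (x k * x k)))))
    - (a k * (a k * (x k * (a k * x k))) + a k * (a k * (x k * (a k * x k))))
    - x k * (a k * x k) + a k * (x k * x k) + a k * x k - (x k * x k + x k * x k)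
    - (x k + x k)
  abel

variable (w : A k)

/-- The rules recur with a tail w because words are kept right-associated, and a rule must also fire
in front of a remaining factor. -/
theorem ab_assoc : a k * (b k * w) = b k * (a k * w) := by rw [← mul_assoc, ab, mul_assoc]
theorem xb_assoc : x k * (b k * w) = b k * (x k * w) := by rw [← mul_assoc, xb, mul_assoc]
theorem yb_assoc : y k * (b k * w) = -(b k * (y k * w)) := by
  rw [← mul_assoc, yb, neg_mul, mul_assoc]
theorem ya_assoc : y k * (a k * w) = a k * (y k * w) := by rw [← mul_assoc, ya, mul_assoc]
theorem yx_assoc : y k * (x k * w) = x k * (y k * w) := by rw [← mul_assoc, yx, mul_assoc]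
theorem aaa_assoc : a k * (a k * (a k * w)) = w := by
  rw [← mul_assoc (a k) (a k) w, ← mul_assoc, aaa, one_mul]
theorem bb_assoc : b k * (b k * w) = w := by rw [← mul_assoc, bb, one_mul]
theorem xaa_assoc : x k * (a k * (a k * w)) =
    -(a k * (x k * (a k * w))) - a k * (a k * (x k * w)) - a k * (a k * w) + w := by
  have h := congrArg (· * w) (xaa (k := k))
  simpa only [mul_assoc, add_mul, sub_mul, neg_mul, one_mul] using h
theorem xxa_assoc : x k * (x k * (a k * w)) =
    -(x k * (a k * (x k * w))) - a k * (x k * (x k * w)) - x k * (a k * w)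
      - a k * (x k * w) := by
  have h := congrArg (· * w) (xxa (k := k))
  simpa only [mul_assoc, add_mul, sub_mul, neg_mul, one_mul] using h
theorem xxx_assoc : x k * (x k * (x k * w)) = y k * (y k * w) - x k * (x k * w) := by
  have h := congrArg (· * w) (xxx (k := k))
  simpa only [mul_assoc, add_mul, sub_mul, neg_mul, one_mul] using h

/-- Exponents range over ℕ in `rightSpan`, so that left multiplication by a or b merely shifts them;
reduction modulo 3 and 2 happens only where the finite list matters. -/
theorem a_pow_mod (i : ℕ) : a k ^ (i % 3) = a k ^ i := by
  conv_rhs => rw [← Nat.mod_add_div i 3, pow_add, pow_mul, relations.aaa, one_pow, mul_one]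

theorem b_pow_mod (j : ℕ) : b k ^ (j % 2) = b k ^ j := by
  conv_rhs => rw [← Nat.mod_add_div j 2, pow_add, pow_mul, pow_two (b k), bb, one_pow, mul_one]

end rules

/-! ### Generation of A as a right B-module. -/

section basis

variable {k : Type*} [Field k] (p q : k)

/-- The generator `x + q a` of `B`. -/
def X (q : k) : A k := x k + q • a k

/-- The generator `y + p b` of `B`. -/
def Y (p : k) : A k := y k + p • b k

theorem X_mem : X q ∈ B p q := Algebra.subset_adjoin (Or.inl rfl)

theorem Y_mem : Y p ∈ B p q := Algebra.subset_adjoin (Or.inr rfl)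

/-- In this and the next two identities the B-coefficients X and Y stand on the right of monomials
aⁱ(xa)ˡ with l < 3, as membership in `rightSpan` requires. This one rests on the second cubic
relation. -/
theorem x_mul_xa : x k * (x k * a k) = -(x k * a k * X q) - a k * X q ^ 2 - x k * a k
    - a k * X q + (q + q ^ 2) • (1 : A k) := by
  simp only [X, pow_two, mul_assoc, mul_add, add_mul, smul_mul_assoc, mul_smul_comm, smul_add,
    smul_sub, smul_neg, aaa, xaa, xxa, xxx, aaa_assoc, xaa_assoc, xxa_assoc, xxx_assoc]
  module

theorem x_mul_xa_sq : x k * (x k * a k) ^ 2 = (-2 : k) • (a k ^ 2 * Y p ^ 2)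
    + (x k * a k) ^ 2 * X q - a k * (x k * a k) * X q ^ 2 - a k * (x k * a k) * X q
    - a k ^ 2 * X q ^ 2 + (1 + q) • X q ^ 2 - a k ^ 2 * X q - (q + q ^ 2) • (x k * a k)
    + (1 + q) • X q + (2 * p ^ 2 - q ^ 2 - q ^ 3) • a k ^ 2 := by
  simp only [X, Y, pow_two, mul_assoc, mul_add, add_mul, mul_sub, sub_mul, neg_mul, mul_neg,
    smul_mul_assoc, mul_smul_comm, smul_add, smul_sub, smul_neg, mul_one, one_mul,
    ab, xb, yb, ya, yx, aaa, bb, xaa, xxa, xxx,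
    ab_assoc, xb_assoc, yb_assoc, ya_assoc, yx_assoc, aaa_assoc, bb_assoc, xaa_assoc,
    xxa_assoc, xxx_assoc]
  module

/-- Here c = 0 enters, through `xaxaxa`; it is the reason why l < 3 suffices. -/
theorem xa_cube : (x k * a k) ^ 3 = (-2 : k) • (a k * (x k * a k) ^ 2 * X q)
    + (3 : k) • (a k ^ 2 * (x k * a k) * X q ^ 2) - q • (a k ^ 2 * (x k * a k) ^ 2)
    - a k * (x k * a k) ^ 2 + (2 : k) • (a k ^ 2 * (x k * a k) * X q)
    + (1 + q) • (x k * a k * X q) - (1 + q) • (a k * X q ^ 2) + (2 : k) • X q ^ 2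
    - (q + q ^ 2) • (a k ^ 2 * X q) + (2 * q + 2 * q ^ 2) • (a k * (x k * a k))
    - (1 + q) • (a k * X q) + (2 : k) • X q + (-q + q ^ 2 + 2 * q ^ 3) • (1 : A k) := by
  simp only [X, Y, pow_succ, pow_zero, mul_assoc, mul_add, add_mul, mul_sub, sub_mul, neg_mul,
    mul_neg, smul_mul_assoc, mul_smul_comm, smul_add, smul_sub, smul_neg, mul_one, one_mul,
    ab, xb, yb, ya, yx, aaa, bb, xaa, xxa, xxx, xaxaxa,
    ab_assoc, xb_assoc, yb_assoc, ya_assoc, yx_assoc, aaa_assoc, bb_assoc, xaa_assoc,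
    xxa_assoc, xxx_assoc]
  module

/-- The right `B`-submodule of `A` generated by the elements `aⁱ bʲ (xa)ˡ` with `l < 3`. -/
def rightSpan : Submodule k (A k) :=
  Submodule.span k {z | ∃ i j : ℕ, ∃ l : Fin 3, ∃ v ∈ B p q,
    z = a k ^ i * b k ^ j * (x k * a k) ^ (l : ℕ) * v}

variable {p q}

theorem rightSpan_induction {P : A k → Prop}
    (hmem : ∀ (i j : ℕ) (l : Fin 3), ∀ v ∈ B p q,
      P (a k ^ i * b k ^ j * (x k * a k) ^ (l : ℕ) * v))
    (h0 : P 0) (hadd : ∀ z w, P z → P w → P (z + w)) (hsmul : ∀ (r : k) z, P z → P (r • z))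
    {z : A k} (hz : z ∈ rightSpan p q) : P z := by
  refine Submodule.span_induction (p := fun z _ => P z) ?_ h0 (fun z w _ _ => hadd z w)
    (fun r z _ => hsmul r z) hz
  rintro _ ⟨i, j, l, v, hv, rfl⟩
  exact hmem i j l v hv

theorem mem_rightSpan (i j : ℕ) (l : Fin 3) {v : A k} (hv : v ∈ B p q) :
    a k ^ i * b k ^ j * (x k * a k) ^ (l : ℕ) * v ∈ rightSpan p q :=
  Submodule.subset_span ⟨i, j, l, v, hv, rfl⟩

theorem rightSpan_mul {z v : A k} (hz : z ∈ rightSpan p q) (hv : v ∈ B p q) :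
    z * v ∈ rightSpan p q := by
  refine rightSpan_induction (P := fun z => z * v ∈ rightSpan p q) ?_ ?_ ?_ ?_ hz
  · intro i j l w hw; rw [mul_assoc]; exact mem_rightSpan i j l (mul_mem hw hv)
  · rw [zero_mul]; exact zero_mem _
  · intro z w hz hw; rw [add_mul]; exact add_mem hz hw
  · intro r z hz; rw [smul_mul_assoc]; exact Submodule.smul_mem _ r hz

theorem a_mul_rightSpan {z : A k} (hz : z ∈ rightSpan p q) : a k * z ∈ rightSpan p q := by
  refine rightSpan_induction (P := fun z => a k * z ∈ rightSpan p q) ?_ ?_ ?_ ?_ hz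
  · intro i j l w hw
    simpa only [pow_succ', mul_assoc] using mem_rightSpan (i + 1) j l hw
  · rw [mul_zero]; exact zero_mem _
  · intro z w hz hw; rw [mul_add]; exact add_mem hz hw
  · intro r z hz; rw [mul_smul_comm]; exact Submodule.smul_mem _ r hz

theorem commute_ab : Commute (a k) (b k) := ab

theorem commute_xa_b : Commute (x k * a k) (b k) := Commute.mul_left xb ab

theorem commute_y_xa : Commute (y k) (x k * a k) := Commute.mul_right yx ya

theorem b_mul_rightSpan {z : A k} (hz : z ∈ rightSpan p q) : b k * z ∈ rightSpan p q := by
  refine rightSpan_induction (P := fun z => b k * z ∈ rightSpan p q) ?_ ?_ ?_ ?_ hz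
  · intro i j l w hw
    have h := (commute_ab (k := k).pow_left i).eq
    have e : b k * (a k ^ i * b k ^ j * (x k * a k) ^ (l : ℕ) * w) =
        a k ^ i * b k ^ (j + 1) * (x k * a k) ^ (l : ℕ) * w := by
      simp only [pow_succ' (b k), ← mul_assoc, h]
    rw [e]
    exact mem_rightSpan i (j + 1) l hw
  · rw [mul_zero]; exact zero_mem _
  · intro z w hz hw; rw [mul_add]; exact add_mem hz hw
  · intro r z hz; rw [mul_smul_comm]; exact Submodule.smul_mem _ r hz

theorem a_pow_mul_rightSpan (i : ℕ) {z : A k} (hz : z ∈ rightSpan p q) :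
    a k ^ i * z ∈ rightSpan p q := by
  induction i with
  | zero => simpa using hz
  | succ i ih => rw [pow_succ', mul_assoc]; exact a_mul_rightSpan ih

theorem b_pow_mul_rightSpan (j : ℕ) {z : A k} (hz : z ∈ rightSpan p q) :
    b k ^ j * z ∈ rightSpan p q := by
  induction j with
  | zero => simpa using hz
  | succ j ih => rw [pow_succ', mul_assoc]; exact b_mul_rightSpan ih

theorem one_mem_rightSpan : (1 : A k) ∈ rightSpan p q := by
  simpa using mem_rightSpan 0 0 0 (one_mem (B p q))

theorem mem_rightSpan_of_mem {v : A k} (hv : v ∈ B p q) : v ∈ rightSpan p q := by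
  simpa using rightSpan_mul one_mem_rightSpan hv

theorem xa_pow_mem_rightSpan (l : Fin 3) : (x k * a k) ^ (l : ℕ) ∈ rightSpan p q := by
  simpa using mem_rightSpan 0 0 l (one_mem (B p q))

theorem xa_mem_rightSpan : x k * a k ∈ rightSpan p q := by
  simpa using xa_pow_mem_rightSpan (p := p) (q := q) 1

theorem xa_sq_mem_rightSpan : (x k * a k) ^ 2 ∈ rightSpan p q :=
  xa_pow_mem_rightSpan 2

theorem xa_cube_mem_rightSpan : (x k * a k) ^ 3 ∈ rightSpan p q := by
  have hX := X_mem p q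
  have hX2 := pow_mem hX 2
  have h1 : (1 : A k) ∈ rightSpan p q := one_mem_rightSpan
  have hxa : x k * a k ∈ rightSpan p q := xa_mem_rightSpan
  have hxa2 : (x k * a k) ^ 2 ∈ rightSpan p q := xa_sq_mem_rightSpan
  have ha := fun {z : A k} (hz : z ∈ rightSpan p q) => a_mul_rightSpan hz
  have ha2 := fun {z : A k} (hz : z ∈ rightSpan p q) => a_pow_mul_rightSpan 2 hz
  have hs := fun (r : k) {z : A k} (hz : z ∈ rightSpan p q) => Submodule.smul_mem _ r hz
  rw [xa_cube q]
  refine add_mem (add_mem (sub_mem (add_mem (sub_mem (add_mem (sub_mem (add_mem (add_mem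
    (sub_mem (sub_mem (add_mem (hs _ ?_) (hs _ ?_)) (hs _ ?_)) ?_) (hs _ ?_)) (hs _ ?_))
    (hs _ ?_)) (hs _ ?_)) (hs _ ?_)) (hs _ ?_)) (hs _ ?_)) (hs _ ?_)) (hs _ ?_)
  · exact rightSpan_mul (ha hxa2) hX
  · exact rightSpan_mul (ha2 hxa) hX2
  · exact ha2 hxa2
  · exact ha hxa2
  · exact rightSpan_mul (ha2 hxa) hX
  · exact rightSpan_mul hxa hX
  · exact ha (mem_rightSpan_of_mem hX2)
  · exact mem_rightSpan_of_mem hX2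
  · exact ha2 (mem_rightSpan_of_mem hX)
  · exact ha hxa
  · exact ha (mem_rightSpan_of_mem hX)
  · exact mem_rightSpan_of_mem hX
  · exact h1

theorem x_mul_xa_pow_mem_rightSpan (l : Fin 3) :
    x k * (x k * a k) ^ (l : ℕ) ∈ rightSpan p q := by
  have hX := X_mem p q
  have hX2 := pow_mem hX 2
  have hY2 := pow_mem (Y_mem p q) 2
  have h1 : (1 : A k) ∈ rightSpan p q := one_mem_rightSpan
  have hxa : x k * a k ∈ rightSpan p q := xa_mem_rightSpan
  have hxa2 : (x k * a k) ^ 2 ∈ rightSpan p q := xa_sq_mem_rightSpan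
  have ha := fun {z : A k} (hz : z ∈ rightSpan p q) => a_mul_rightSpan hz
  have ha2 := fun {z : A k} (hz : z ∈ rightSpan p q) => a_pow_mul_rightSpan 2 hz
  have hs := fun (r : k) {z : A k} (hz : z ∈ rightSpan p q) => Submodule.smul_mem _ r hz
  fin_cases l
  · have e : x k = X q - q • (a k * 1) := by rw [X, mul_one, add_sub_cancel_right]
    simp only [pow_zero, mul_one]
    rw [e]
    exact sub_mem (mem_rightSpan_of_mem hX) (hs _ (ha h1))
  · simp only [pow_one]
    rw [x_mul_xa q]
    refine add_mem (sub_mem (sub_mem (sub_mem (neg_mem ?_) ?_) hxa) ?_) (hs _ h1)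
    · exact rightSpan_mul hxa hX
    · exact ha (mem_rightSpan_of_mem hX2)
    · exact ha (mem_rightSpan_of_mem hX)
  · change x k * (x k * a k) ^ 2 ∈ _
    rw [x_mul_xa_sq p q]
    refine add_mem (add_mem (sub_mem (sub_mem (add_mem (sub_mem (sub_mem (sub_mem (add_mem
      (hs _ ?_) ?_) ?_) ?_) ?_) (hs _ ?_)) ?_) (hs _ ?_)) (hs _ ?_)) (hs _ ?_)
    · exact ha2 (mem_rightSpan_of_mem hY2)
    · exact rightSpan_mul hxa2 hX
    · exact rightSpan_mul (ha hxa) hX2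
    · exact rightSpan_mul (ha hxa) hX
    · exact ha2 (mem_rightSpan_of_mem hX2)
    · exact mem_rightSpan_of_mem hX2
    · exact ha2 (mem_rightSpan_of_mem hX)
    · exact hxa
    · exact mem_rightSpan_of_mem hX
    · simpa using ha2 h1

/-- Modulo 3 there are three cases: i = 0 is `x_mul_xa_pow_mem_rightSpan`, i = 1 gives (xa)ˡ⁺¹, and
i = 2 reduces to the other two by the rule for xa². -/
theorem x_mul_a_pow_mul_mem_rightSpan (i : ℕ) (l : Fin 3) :
    x k * (a k ^ i * (x k * a k) ^ (l : ℕ)) ∈ rightSpan p q := by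
  have h₁ : x k * (a k * (x k * a k) ^ (l : ℕ)) ∈ rightSpan p q := by
    rw [← mul_assoc, ← pow_succ']
    fin_cases l
    · simpa using xa_mem_rightSpan
    · exact xa_sq_mem_rightSpan
    · exact xa_cube_mem_rightSpan
  rw [← a_pow_mod]
  have : i % 3 < 3 := Nat.mod_lt _ (by norm_num)
  interval_cases i % 3
  · simpa using x_mul_xa_pow_mem_rightSpan l
  · simpa using h₁
  · rw [pow_two, mul_assoc, xaa_assoc]
    have h := xa_pow_mem_rightSpan (p := p) (q := q) l
    exact add_mem (sub_mem (sub_mem (neg_mem (a_mul_rightSpan h₁)) (a_mul_rightSpan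
      (a_mul_rightSpan (x_mul_xa_pow_mem_rightSpan l)))) (a_mul_rightSpan (a_mul_rightSpan h))) h

theorem x_mul_rightSpan {z : A k} (hz : z ∈ rightSpan p q) : x k * z ∈ rightSpan p q := by
  refine rightSpan_induction (P := fun z => x k * z ∈ rightSpan p q) ?_ ?_ ?_ ?_ hz
  · intro i j l w hw
    have h₁ : a k ^ i * b k ^ j = b k ^ j * a k ^ i := (commute_ab (k := k).pow_pow i j).eq
    have h₂ : x k * b k ^ j = b k ^ j * x k := Commute.pow_right (show Commute _ _ from xb) j
    have e : x k * (a k ^ i * b k ^ j * (x k * a k) ^ (l : ℕ) * w) =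
        b k ^ j * (x k * (a k ^ i * (x k * a k) ^ (l : ℕ)) * w) := by
      simp only [← mul_assoc, ← h₂]
      simp only [mul_assoc (x k), h₁]
    rw [e]
    exact b_pow_mul_rightSpan j (rightSpan_mul (x_mul_a_pow_mul_mem_rightSpan i l) hw)
  · rw [mul_zero]; exact zero_mem _
  · intro z w hz hw; rw [mul_add]; exact add_mem hz hw
  · intro r z hz; rw [mul_smul_comm]; exact Submodule.smul_mem _ r hz

/-- The element y commutes with a and xa and anticommutes with b, so up to sign it moves next to the
coefficient w in B. There y = Y - pb: the factor Y is absorbed into B and b travels back to the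
left. -/
theorem y_mul_rightSpan {z : A k} (hz : z ∈ rightSpan p q) : y k * z ∈ rightSpan p q := by
  refine rightSpan_induction (P := fun z => y k * z ∈ rightSpan p q) ?_ ?_ ?_ ?_ hz
  · intro i j l w hw
    have h₁ : y k * a k ^ i = a k ^ i * y k := Commute.pow_right (show Commute _ _ from ya) i
    have h₂ : y k * b k ^ j = (-1 : k) ^ j • (b k ^ j * y k) := by
      induction j with
      | zero => simp
      | succ j ih =>
        rw [pow_succ, ← mul_assoc, ih, smul_mul_assoc, mul_assoc, yb, pow_succ, mul_assoc]
        simp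
    have h₃ : y k * (x k * a k) ^ (l : ℕ) = (x k * a k) ^ (l : ℕ) * y k :=
      (commute_y_xa (k := k).pow_right l).eq
    have h₄ : (x k * a k) ^ (l : ℕ) * b k = b k * (x k * a k) ^ (l : ℕ) :=
      (commute_xa_b (k := k).pow_left l).eq
    have e : y k * (a k ^ i * b k ^ j * (x k * a k) ^ (l : ℕ) * w) =
        (-1 : k) ^ j • (a k ^ i * b k ^ j * (x k * a k) ^ (l : ℕ) * (Y p * w)
          - p • (a k ^ i * b k ^ (j + 1) * (x k * a k) ^ (l : ℕ) * w)) := by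
      have e₁ : y k * (a k ^ i * b k ^ j * (x k * a k) ^ (l : ℕ) * w) =
          (-1 : k) ^ j • (a k ^ i * b k ^ j * (x k * a k) ^ (l : ℕ) * (y k * w)) := by
        rw [mul_assoc (a k ^ i * b k ^ j), mul_assoc (a k ^ i), ← mul_assoc (y k), h₁,
          mul_assoc (a k ^ i), ← mul_assoc (y k), h₂, smul_mul_assoc, mul_smul_comm,
          mul_assoc (b k ^ j), ← mul_assoc (y k), h₃]
        simp only [mul_assoc]
      rw [e₁, Y, add_mul, mul_add, smul_mul_assoc, mul_smul_comm, pow_succ]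
      congr 1
      rw [eq_sub_iff_add_eq, add_right_inj]
      congr 1
      rw [← mul_assoc _ (b k) w, mul_assoc _ _ (b k), h₄]
      simp only [mul_assoc]
    rw [e]
    exact Submodule.smul_mem _ _ (sub_mem (mem_rightSpan i j l (mul_mem (Y_mem p q) hw))
      (Submodule.smul_mem _ _ (mem_rightSpan i (j + 1) l hw)))
  · rw [mul_zero]; exact zero_mem _
  · intro z w hz hw; rw [mul_add]; exact add_mem hz hw
  · intro r z hz; rw [mul_smul_comm]; exact Submodule.smul_mem _ r hz

/-- `A` is generated as a right `B`-module by the elements `aⁱ bʲ (xa)ˡ` with `l < 3`. -/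
theorem rightSpan_eq_top : rightSpan p q = ⊤ := by
  -- Quantifying over z inside the induction on u is what lets the product case apply the two
  -- factors in succession.
  have key : ∀ u : Tilde k, ∀ z ∈ rightSpan p q,
      Ideal.Quotient.mk (Tilde.idealC k) u * z ∈ rightSpan p q := by
    intro u
    induction u using Tilde.induction with
    | hr r =>
      intro z hz
      change algebraMap k (A k) r * z ∈ _
      rw [← Algebra.smul_def]
      exact Submodule.smul_mem _ r hz
    | ha => exact fun z hz => a_mul_rightSpan hz
    | hb => exact fun z hz => b_mul_rightSpan hz
    | hx => exact fun z hz => x_mul_rightSpan hz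
    | hy => exact fun z hz => y_mul_rightSpan hz
    | hadd u v hu hv =>
      intro z hz
      rw [map_add, add_mul]
      exact add_mem (hu z hz) (hv z hz)
    | hmul u v hu hv =>
      intro z hz
      rw [map_mul, mul_assoc]
      exact hu _ (hv z hz)
  refine eq_top_iff.2 fun z _ => ?_
  obtain ⟨u, rfl⟩ := Ideal.Quotient.mk_surjective z
  simpa using key u 1 one_mem_rightSpan

end basis

end NodalCubic.A

/-! ### The representation of `A` on `k¹⁸` and the basis of `A/AB⁺` -/

namespace NodalCubic.A

open HopfCleft

section rep

variable {k : Type*} [Field k] (p q : k)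

/-- The standard basis of `k¹⁸`. -/
noncomputable def stdBasis (k : Type*) [Field k] :
    Module.Basis (Fin 3 × Fin 2 × Fin 3) k (Fin 3 × Fin 2 × Fin 3 → k) :=
  Pi.basisFun k _

/-- The standard basis vectors of `k¹⁸`. -/
noncomputable def e (i : Fin 3) (j : Fin 2) (l : Fin 3) : Fin 3 × Fin 2 × Fin 3 → k :=
  stdBasis k (i, j, l)

/-- The action of `a` on `k¹⁸`. -/
noncomputable def repA (k : Type*) [Field k] : Module.End k (Fin 3 × Fin 2 × Fin 3 → k) :=
  (stdBasis k).constr k fun (i, j, l) => e (i + 1) j l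

/-- The action of `b` on `k¹⁸`. -/
noncomputable def repB (k : Type*) [Field k] : Module.End k (Fin 3 × Fin 2 × Fin 3 → k) :=
  (stdBasis k).constr k fun (i, j, l) => e i (j + 1) l

/-- The action of `y` on `k¹⁸`. -/
noncomputable def repY : Module.End k (Fin 3 × Fin 2 × Fin 3 → k) :=
  -- The second index drops out: Ye₀ = pe₀ forces ye₀ = p(e₀ - be₀), and passing y across b changes
  -- the sign while b swaps the two terms.
  (stdBasis k).constr k fun (i, _, l) => p • (e i 0 l - e i 1 l)

/-- The vectors `x aⁱ bʲ (xa)ˡ` of `k¹⁸`. -/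
noncomputable def repXVec (j : Fin 2) : Fin 3 → Fin 3 → (Fin 3 × Fin 2 × Fin 3 → k)
  -- The entries are the rules for x aⁱ(xa)ˡ with right factors from B replaced by their counits, X
  -- by q and Y by p. Row 0 comes from X = x + qa, `x_mul_xa` and `x_mul_xa_sq` (where p cancels),
  -- row 1 from (xa)ˡ⁺¹ and `xa_cube`, row 2 from `xaa`.
  | 0, 0 => q • e 0 j 0 - q • e 1 j 0
  | 0, 1 => (q + q ^ 2) • e 0 j 0 - (1 + q) • e 0 j 1 - (q + q ^ 2) • e 1 j 0
  | 0, 2 => (q + 2 * q ^ 2 + q ^ 3) • e 0 j 0 - (q + q ^ 2) • e 0 j 1 + q • e 0 j 2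
      - (q + q ^ 2) • e 1 j 1 - (q + 2 * q ^ 2 + q ^ 3) • e 2 j 0
  | 1, 0 => e 0 j 1
  | 1, 1 => e 0 j 2
  | 1, 2 => (q + 3 * q ^ 2 + 2 * q ^ 3) • e 0 j 0 + (q + q ^ 2) • e 0 j 1
      - (q + 2 * q ^ 2 + q ^ 3) • e 1 j 0 + (2 * q + 2 * q ^ 2) • e 1 j 1
      - (1 + 2 * q) • e 1 j 2 - (q ^ 2 + q ^ 3) • e 2 j 0
      + (2 * q + 3 * q ^ 2) • e 2 j 1 - q • e 2 j 2
  | 2, 0 => (1 + q) • e 0 j 0 - e 1 j 1 - (1 + q) • e 2 j 0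
  | 2, 1 => (q + q ^ 2) • e 0 j 0 + e 0 j 1 - e 1 j 2 - (q + q ^ 2) • e 2 j 0 + q • e 2 j 1
  | 2, 2 => (q ^ 2 + q ^ 3) • e 0 j 0 - (q + 2 * q ^ 2) • e 0 j 1 + (1 + q) • e 0 j 2
      - (q ^ 2 + q ^ 3) • e 1 j 0 - (q + q ^ 2) • e 1 j 1
      - (q + q ^ 2) • e 2 j 1 + q • e 2 j 2

/-- The action of `x` on `k¹⁸`. -/
noncomputable def repX : Module.End k (Fin 3 × Fin 2 × Fin 3 → k) :=
  (stdBasis k).constr k fun (i, j, l) => repXVec q j i l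

theorem repA_e (i : Fin 3) (j : Fin 2) (l : Fin 3) : repA k (e i j l) = e (i + 1) j l :=
  (stdBasis k).constr_basis k _ _

theorem repB_e (i : Fin 3) (j : Fin 2) (l : Fin 3) : repB k (e i j l) = e i (j + 1) l :=
  (stdBasis k).constr_basis k _ _

theorem repY_e (i : Fin 3) (j : Fin 2) (l : Fin 3) :
    repY p (e i j l) = p • (e i 0 l - e i 1 l) :=
  (stdBasis k).constr_basis k _ _

theorem repX_e (i : Fin 3) (j : Fin 2) (l : Fin 3) : repX q (e i j l) = repXVec q j i l :=
  (stdBasis k).constr_basis k _ _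

theorem end_ext {f g : Module.End k (Fin 3 × Fin 2 × Fin 3 → k)}
    (h : ∀ i j l, f (e i j l) = g (e i j l)) : f = g :=
  (stdBasis k).ext fun (i, j, l) => h i j l

theorem fin_three_two_add_one : (2 : Fin 3) + 1 = 0 := rfl
theorem fin_three_one_add_one : (1 : Fin 3) + 1 = 2 := rfl
theorem fin_two_one_add_one : (1 : Fin 2) + 1 = 0 := rfl
theorem fin_two_add_one_add_one (j : Fin 2) : j + 1 + 1 = j := by
  fin_cases j <;> rfl

theorem repA_cube : repA k ^ 3 = 1 := by
  refine end_ext fun i j l => ?_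
  fin_cases i <;>
  simp only [pow_succ, pow_zero, one_mul, Module.End.mul_apply, Module.End.one_apply, repA_e,
    Fin.zero_eta, Fin.mk_one, Fin.reduceFinMk, zero_add, fin_three_two_add_one,
    fin_three_one_add_one]

theorem repB_sq : repB k ^ 2 = 1 := by
  refine end_ext fun i j l => ?_
  simp only [pow_two, Module.End.mul_apply, Module.End.one_apply, repB_e,
    fin_two_add_one_add_one]

theorem repY_sq : repY p ^ 2 = 0 := by
  refine end_ext fun i j l => ?_
  simp only [pow_two, Module.End.mul_apply, LinearMap.zero_apply, repY_e, map_smul, map_sub]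
  module

set_option maxHeartbeats 1600000 in
theorem repX_sq_add_cube : repX q ^ 2 + repX q ^ 3 = 0 := by
  refine end_ext fun i j l => ?_
  fin_cases i <;> fin_cases l <;>
  simp only [pow_succ, pow_zero, one_mul, Module.End.mul_apply, Module.End.one_apply,
    LinearMap.add_apply, LinearMap.sub_apply, LinearMap.zero_apply,
    repA_e, repX_e, repXVec, map_smul, map_sub, map_add,
    Fin.zero_eta, Fin.mk_one, Fin.reduceFinMk, zero_add, fin_three_two_add_one,
    fin_three_one_add_one] <;> module

set_option maxHeartbeats 1600000 in
theorem rep_cubic₁ : repA k ^ 2 * repX q + repA k * repX q * repA k + repX q * repA k ^ 2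
    + repA k ^ 2 - 1 = 0 := by
  refine end_ext fun i j l => ?_
  fin_cases i <;> fin_cases l <;>
  simp only [pow_succ, pow_zero, one_mul, Module.End.mul_apply, Module.End.one_apply,
    LinearMap.add_apply, LinearMap.sub_apply, LinearMap.zero_apply,
    repA_e, repX_e, repXVec, map_smul, map_sub, map_add,
    Fin.zero_eta, Fin.mk_one, Fin.reduceFinMk, zero_add, fin_three_two_add_one,
    fin_three_one_add_one] <;> module

set_option maxHeartbeats 1600000 in
theorem rep_cubic₂ : repX q ^ 2 * repA k + repX q * repA k * repX q + repA k * repX q ^ 2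
    + repX q * repA k + repA k * repX q = 0 := by
  refine end_ext fun i j l => ?_
  fin_cases i <;> fin_cases l <;>
  simp only [pow_succ, pow_zero, one_mul, Module.End.mul_apply, Module.End.one_apply,
    LinearMap.add_apply, LinearMap.sub_apply, LinearMap.zero_apply,
    repA_e, repX_e, repXVec, map_smul, map_sub, map_add,
    Fin.zero_eta, Fin.mk_one, Fin.reduceFinMk, zero_add, fin_three_two_add_one,
    fin_three_one_add_one] <;> module

set_option maxHeartbeats 1600000 in
theorem rep_relations : Relations (repA k) (repB k) (repX q) (repY p) where
  ba := end_ext fun i j l => by simp only [Module.End.mul_apply, repA_e, repB_e]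
  ya := end_ext fun i j l => by simp only [Module.End.mul_apply, repA_e, repY_e, map_smul, map_sub]
  bx := end_ext fun i j l => by
    fin_cases i <;> fin_cases l <;>
    simp only [Module.End.mul_apply, repB_e, repX_e, repXVec, map_smul, map_sub, map_add,
      Fin.zero_eta, Fin.mk_one, Fin.reduceFinMk]
  yx := end_ext fun i j l => by
    fin_cases i <;> fin_cases l <;>
    simp only [Module.End.mul_apply, repY_e, repX_e, repXVec, map_smul, map_sub, map_add,
      Fin.zero_eta, Fin.mk_one, Fin.reduceFinMk] <;> module
  by_ := end_ext fun i j l => by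
    simp only [Module.End.mul_apply, LinearMap.neg_apply, repB_e, repY_e, map_smul, map_sub,
      zero_add, fin_two_one_add_one]
    module
  cubic₁ := by rw [repA_cube, rep_cubic₁]
  cubic₂ := rep_cubic₂ q
  -- Both sides of y² = x² + x³ act as zero.
  yy := by rw [repY_sq, repX_sq_add_cube]
  bb := by rw [repB_sq, repA_cube]
  aaa := repA_cube

/-- The representation of `Ã` on `k¹⁸`. -/
noncomputable def tildeRep : Tilde k →ₐ[k] Module.End k (Fin 3 × Fin 2 × Fin 3 → k) :=
  Tilde.lift (rep_relations p q)

/-- The first basis vector is therefore cyclic, and the monomials applied to it give the whole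
standard basis. -/
theorem rep_monomial (i : Fin 3) (j : Fin 2) (l : Fin 3) :
    (repA k ^ (i : ℕ) * repB k ^ (j : ℕ) * (repX q * repA k) ^ (l : ℕ)) (e 0 0 0) = e i j l := by
  fin_cases i <;> fin_cases j <;> fin_cases l <;>
  simp only [pow_succ, pow_zero, one_mul, mul_one, Module.End.mul_apply, Module.End.one_apply,
      repA_e, repB_e, repX_e, repXVec,
      Fin.zero_eta, Fin.mk_one, Fin.reduceFinMk, zero_add, fin_three_two_add_one,
      fin_three_one_add_one, fin_two_add_one_add_one, Fin.val_zero, Fin.val_one, Fin.val_two]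

/-- Since c is central and e₀ is cyclic, it is enough that c kills e₀; this avoids evaluating c on
all eighteen vectors. -/
theorem tildeRep_c : tildeRep p q (Tilde.c k) = 0 := by
  have h0 : tildeRep p q (Tilde.c k) (e 0 0 0) = 0 := by
    rw [Tilde.c_eq]
    simp only [map_add, map_sub, map_mul, tildeRep, Tilde.lift_a, Tilde.lift_x,
      LinearMap.add_apply, LinearMap.sub_apply, Module.End.mul_apply,
      repA_e, repX_e, repXVec, map_smul,
      zero_add, fin_three_two_add_one, fin_three_one_add_one]
    module
  refine end_ext fun i j l => ?_
  have h := congrArg (tildeRep p q) (Tilde.c_central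
    (Tilde.a k ^ (i : ℕ) * Tilde.b k ^ (j : ℕ) * (Tilde.x k * Tilde.a k) ^ (l : ℕ)))
  rw [map_mul, map_mul _ _ (Tilde.c k)] at h
  simp only [map_mul (tildeRep p q) (_ * _) (_ ^ _), map_mul (tildeRep p q) (_ ^ _) (_ ^ _),
    map_mul (tildeRep p q) (Tilde.x k) (Tilde.a k), map_pow] at h
  have ha : tildeRep p q (Tilde.a k) = repA k := Tilde.lift_a _
  have hb : tildeRep p q (Tilde.b k) = repB k := Tilde.lift_b _
  have hx : tildeRep p q (Tilde.x k) = repX q := Tilde.lift_x _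
  rw [ha, hb, hx] at h
  have h' := LinearMap.congr_fun h (e 0 0 0)
  rw [Module.End.mul_apply, Module.End.mul_apply _ (tildeRep p q (Tilde.c k)), rep_monomial, h0,
    map_zero] at h'
  rw [h', LinearMap.zero_apply]

/-- The representation of `A` on `k¹⁸`. -/
noncomputable def rep : A k →ₐ[k] Module.End k (Fin 3 × Fin 2 × Fin 3 → k) :=
  Ideal.Quotient.liftₐ (Tilde.idealC k) (tildeRep p q) fun z hz => by
    obtain ⟨u, rfl⟩ := Tilde.mem_idealC.1 hz
    rw [map_mul, tildeRep_c, mul_zero]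

theorem rep_a : rep p q (a k) = repA k := Tilde.lift_a _
theorem rep_b : rep p q (b k) = repB k := Tilde.lift_b _
theorem rep_x : rep p q (x k) = repX q := Tilde.lift_x _
theorem rep_y : rep p q (y k) = repY p := Tilde.lift_y _

end rep

/-! ### The eighteen classes as a basis of A/AB⁺. -/

section basis

variable {k : Type*} [Field k] (p q : k)

theorem counit_a : Coalgebra.counit (R := k) (a k) = 1 := Tilde.counit_a
theorem counit_b : Coalgebra.counit (R := k) (b k) = 1 := Tilde.counit_b
theorem counit_x : Coalgebra.counit (R := k) (x k) = 0 := Tilde.counit_x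
theorem counit_y : Coalgebra.counit (R := k) (y k) = 0 := Tilde.counit_y

theorem counit_X : Coalgebra.counit (R := k) (X q) = q := by
  simp [X, counit_a, counit_x]

theorem counit_Y : Coalgebra.counit (R := k) (Y p) = p := by
  simp [Y, counit_b, counit_y]

/-- The vector e₀ is an eigenvector of X and Y with eigenvalues q = ε(X) and p = ε(Y), hence of all
of B with character ε. So AB⁺ annihilates e₀. -/
theorem rep_of_mem {v : A k} (hv : v ∈ B p q) :
    rep p q v (e 0 0 0) = Coalgebra.counit (R := k) v • e 0 0 0 := by
  induction hv using Algebra.adjoin_induction with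
  | mem v hv =>
    rcases hv with rfl | rfl
    · have h := counit_X q
      rw [X] at h
      rw [h]
      simp only [map_add, map_smul, rep_a, rep_x, LinearMap.add_apply, LinearMap.smul_apply,
        repA_e, repX_e, repXVec, zero_add]
      module
    · have h := counit_Y p
      rw [Y] at h
      rw [h]
      simp only [map_add, map_smul, rep_b, rep_y, LinearMap.add_apply, LinearMap.smul_apply,
        repB_e, repY_e, zero_add]
      module
  | algebraMap r => simp [Algebra.algebraMap_eq_smul_one]
  | add u v _ _ hu hv => simp only [map_add, LinearMap.add_apply, hu, hv, add_smul]
  | mul u v _ _ hu hv =>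
    simp only [map_mul, Module.End.mul_apply, hu, hv, map_smul, Bialgebra.counit_mul, mul_smul]
    rw [smul_comm]

/-- The map `A/AB⁺ → k¹⁸`, `[z] ↦ z e₀`. -/
noncomputable def quotientRep : (A k ⧸ leftIdealPlus (B p q)) →ₗ[k] (Fin 3 × Fin 2 × Fin 3 → k) :=
  (leftIdealPlus (B p q)).liftQ ((LinearMap.applyₗ (e 0 0 0)) ∘ₗ (rep p q).toLinearMap)
    fun z hz => by
      refine leftIdealPlus_induction (P := fun z => z ∈ LinearMap.ker _) (zero_mem _)
        (fun z w => add_mem) (fun z v hv h => ?_) hz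
      simp [LinearMap.mem_ker, rep_of_mem p q hv, h]

theorem quotientRep_mkQ (z : A k) :
    quotientRep p q ((leftIdealPlus (B p q)).mkQ z) = rep p q z (e 0 0 0) := rfl

theorem quotientRep_monomial (i : Fin 3) (j : Fin 2) (l : Fin 3) :
    quotientRep p q ((leftIdealPlus (B p q)).mkQ
      (a k ^ (i : ℕ) * b k ^ (j : ℕ) * (x k * a k) ^ (l : ℕ))) = e i j l := by
  rw [quotientRep_mkQ]
  simp only [map_mul, map_pow, rep_a, rep_b, rep_x, rep_monomial]

theorem linearIndependent_monomial : LinearIndependent k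
    fun t : Fin 3 × Fin 2 × Fin 3 => (leftIdealPlus (B p q)).mkQ
      (a k ^ (t.1 : ℕ) * b k ^ (t.2.1 : ℕ) * (x k * a k) ^ (t.2.2 : ℕ)) := by
  refine LinearIndependent.of_comp (quotientRep p q) ?_
  have h : quotientRep p q ∘ (fun t : Fin 3 × Fin 2 × Fin 3 => (leftIdealPlus (B p q)).mkQ
      (a k ^ (t.1 : ℕ) * b k ^ (t.2.1 : ℕ) * (x k * a k) ^ (t.2.2 : ℕ))) = stdBasis k :=
    funext fun t => quotientRep_monomial p q t.1 t.2.1 t.2.2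
  rw [h]
  exact (stdBasis k).linearIndependent

/-- In the right B-module generators of A, the coefficients become scalars modulo AB⁺. -/
theorem span_monomial : ⊤ ≤ Submodule.span k (Set.range
    fun t : Fin 3 × Fin 2 × Fin 3 => (leftIdealPlus (B p q)).mkQ
      (a k ^ (t.1 : ℕ) * b k ^ (t.2.1 : ℕ) * (x k * a k) ^ (t.2.2 : ℕ))) := by
  intro u _
  obtain ⟨z, rfl⟩ := (leftIdealPlus (B p q)).mkQ_surjective u
  have hz : z ∈ rightSpan p q := by rw [rightSpan_eq_top]; trivial
  refine rightSpan_induction (p := p) (q := q)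
    (P := fun z => (leftIdealPlus (B p q)).mkQ z ∈ Submodule.span k _)
    (fun i j l v hv => ?_) (by simp) (fun z w hz hw => by rw [map_add]; exact add_mem hz hw)
    (fun r z hz => by rw [map_smul]; exact Submodule.smul_mem _ r hz) hz
  rw [mkQ_mul_of_mem _ hv, ← a_pow_mod, ← b_pow_mod]
  exact Submodule.smul_mem _ _ (Submodule.subset_span
    ⟨(⟨i % 3, Nat.mod_lt _ (by norm_num)⟩, ⟨j % 2, Nat.mod_lt _ (by norm_num)⟩, l), rfl⟩)

/-- The basis `[aⁱ bʲ (xa)ˡ]` of `A/AB⁺`. -/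
noncomputable def quotientBasis :
    Module.Basis (Fin 3 × Fin 2 × Fin 3) k (A k ⧸ leftIdealPlus (B p q)) :=
  Module.Basis.mk (linearIndependent_monomial p q) (span_monomial p q)

theorem quotientBasis_apply (i : Fin 3) (j : Fin 2) (l : Fin 3) :
    quotientBasis p q (i, j, l) = (leftIdealPlus (B p q)).mkQ
      (a k ^ (i : ℕ) * b k ^ (j : ℕ) * (x k * a k) ^ (l : ℕ)) :=
  Module.Basis.mk_apply _ _ _

end basis

end NodalCubic.A

/-! ### The cleaving map -/

namespace HopfCleft

open Coalgebra

variable {k A : Type*} [Field k] [Ring A] [HopfAlgebra k A]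

/-- Left multiplication by an element of `A` on `A/AB⁺`. -/
noncomputable def quotientMulLeft (B : Subalgebra k A) (g : A) :
    (A ⧸ leftIdealPlus B) →ₗ[k] (A ⧸ leftIdealPlus B) :=
  (leftIdealPlus B).mapQ (leftIdealPlus B) (LinearMap.mulLeft k g)
    fun _ hz => Ideal.mul_mem_left _ g hz

theorem quotientMulLeft_mkQ (B : Subalgebra k A) (g z : A) :
    quotientMulLeft B g ((leftIdealPlus B).mkQ z) = (leftIdealPlus B).mkQ (g * z) := rfl

theorem rTensor_mkQ_tmul_mul (B : Subalgebra k A) (g : A) (t : A ⊗[k] A) :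
    (leftIdealPlus B).mkQ.rTensor A (g ⊗ₜ g * t) =
      TensorProduct.map (quotientMulLeft B g) (LinearMap.mulLeft k g)
        ((leftIdealPlus B).mkQ.rTensor A t) := by
  induction t with
  | zero => simp
  | add t₁ t₂ h₁ h₂ => simp only [mul_add, map_add, h₁, h₂]
  | tmul t₁ t₂ =>
    simp only [Algebra.TensorProduct.tmul_mul_tmul, TensorProduct.map_tmul,
      LinearMap.rTensor_tmul, quotientMulLeft_mkQ, LinearMap.mulLeft_apply]

end HopfCleft

/-! ### Comultiplication on A, the map γ and its convolution inverse. -/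

namespace NodalCubic.A

open HopfCleft Coalgebra

variable {k : Type*} [Field k]

theorem comul_a : comul (R := k) (a k) = a k ⊗ₜ a k :=
  congrArg (TensorProduct.map (Ideal.Quotient.mkₐ k (Tilde.idealC k)).toLinearMap
    (Ideal.Quotient.mkₐ k (Tilde.idealC k)).toLinearMap) (Tilde.comul_a (k := k))

theorem comul_b : comul (R := k) (b k) = b k ⊗ₜ b k :=
  congrArg (TensorProduct.map (Ideal.Quotient.mkₐ k (Tilde.idealC k)).toLinearMap
    (Ideal.Quotient.mkₐ k (Tilde.idealC k)).toLinearMap) (Tilde.comul_b (k := k))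

theorem comul_x : comul (R := k) (x k) = 1 ⊗ₜ x k + x k ⊗ₜ a k :=
  (congrArg (TensorProduct.map (Ideal.Quotient.mkₐ k (Tilde.idealC k)).toLinearMap
    (Ideal.Quotient.mkₐ k (Tilde.idealC k)).toLinearMap) (Tilde.comul_x (k := k))).trans
    (map_add _ _ _)

theorem comul_y : comul (R := k) (y k) = 1 ⊗ₜ y k + y k ⊗ₜ b k :=
  (congrArg (TensorProduct.map (Ideal.Quotient.mkₐ k (Tilde.idealC k)).toLinearMap
    (Ideal.Quotient.mkₐ k (Tilde.idealC k)).toLinearMap) (Tilde.comul_y (k := k))).trans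
    (map_add _ _ _)

theorem comul_group (i j : ℕ) : comul (R := k) (a k ^ i * b k ^ j) =
    (a k ^ i * b k ^ j) ⊗ₜ (a k ^ i * b k ^ j) := by
  have h := map_mul (Bialgebra.comulAlgHom k (A k)) (a k ^ i) (b k ^ j)
  simp only [map_pow, Bialgebra.comulAlgHom_apply, comul_a, comul_b,
    Algebra.TensorProduct.tmul_pow, Algebra.TensorProduct.tmul_mul_tmul] at h
  exact h

theorem counit_group_mul (i j : ℕ) (z : A k) :
    counit (R := k) (a k ^ i * b k ^ j * z) = counit (R := k) z := by
  simp only [Bialgebra.counit_mul, Bialgebra.counit_pow, counit_a, counit_b, one_pow, one_mul]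

theorem comul_xa : comul (R := k) (x k * a k) =
    a k ⊗ₜ (x k * a k) + (x k * a k) ⊗ₜ (a k * a k) := by
  rw [Bialgebra.comul_mul, comul_x, comul_a, add_mul]
  simp only [Algebra.TensorProduct.tmul_mul_tmul, one_mul]

theorem comul_xa_sq : comul (R := k) ((x k * a k) ^ 2) =
    (a k * a k) ⊗ₜ (x k * (a k * (x k * a k))) + (a k * (x k * a k)) ⊗ₜ x k
      + (x k * (a k * a k)) ⊗ₜ (a k * (a k * (x k * a k)))
      + (x k * (a k * (x k * a k))) ⊗ₜ a k := by
  rw [pow_two, Bialgebra.comul_mul, comul_xa]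
  simp only [add_mul, mul_add, Algebra.TensorProduct.tmul_mul_tmul, mul_assoc, aaa, mul_one]
  abel

theorem isRightCoideal_B (p q : k) : IsRightCoideal (B p q) := by
  refine isRightCoideal_adjoin fun z hz => ?_
  change _ ∈ LinearMap.range ((Subalgebra.toSubmodule (B p q)).subtype.rTensor (A k))
  rcases hz with rfl | rfl
  · refine ⟨(1 : B p q) ⊗ₜ x k + (⟨X q, X_mem p q⟩ : B p q) ⊗ₜ a k, ?_⟩
    have h : comul (R := k) (x k + q • a k) =
        1 ⊗ₜ x k + x k ⊗ₜ a k + q • a k ⊗ₜ a k := by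
      rw [map_add, map_smul, comul_x, comul_a]
    rw [h, map_add, LinearMap.rTensor_tmul, LinearMap.rTensor_tmul]
    change 1 ⊗ₜ x k + (x k + q • a k) ⊗ₜ a k = _
    rw [TensorProduct.add_tmul, TensorProduct.smul_tmul', add_assoc]
  · refine ⟨(1 : B p q) ⊗ₜ y k + (⟨Y p, Y_mem p q⟩ : B p q) ⊗ₜ b k, ?_⟩
    have h : comul (R := k) (y k + p • b k) =
        1 ⊗ₜ y k + y k ⊗ₜ b k + p • b k ⊗ₜ b k := by
      rw [map_add, map_smul, comul_y, comul_b]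
    rw [h, map_add, LinearMap.rTensor_tmul, LinearMap.rTensor_tmul]
    change 1 ⊗ₜ y k + (y k + p • b k) ⊗ₜ b k = _
    rw [TensorProduct.add_tmul, TensorProduct.smul_tmul', add_assoc]

instance isCoideal_B (p q : k) : (leftIdealPlus (B p q)).IsCoideal :=
  isCoideal_leftIdealPlus (isRightCoideal_B p q)

variable (p q : k)

/-! #### Classes in `A/AB⁺` -/

/-- As X acts by q on the right of A/AB⁺, a trailing x may be replaced by q - qa. The formulas below
are instances of this. -/
theorem mkQ_mul_x (z : A k) : (leftIdealPlus (B p q)).mkQ (z * x k) =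
    q • (leftIdealPlus (B p q)).mkQ z - q • (leftIdealPlus (B p q)).mkQ (z * a k) := by
  have h := mkQ_mul_of_mem z (X_mem p q)
  rw [counit_X, X, mul_add, mul_smul_comm, map_add, map_smul] at h
  exact eq_sub_of_add_eq h

theorem mkQ_x : (leftIdealPlus (B p q)).mkQ (x k) =
    q • (leftIdealPlus (B p q)).mkQ 1 - q • (leftIdealPlus (B p q)).mkQ (a k) := by
  simpa only [one_mul] using mkQ_mul_x p q 1

theorem mkQ_aax : (leftIdealPlus (B p q)).mkQ (a k * (a k * x k)) =
    q • (leftIdealPlus (B p q)).mkQ (a k * a k) - q • (leftIdealPlus (B p q)).mkQ 1 := by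
  simpa only [mul_assoc, aaa] using mkQ_mul_x p q (a k * a k)

theorem mkQ_xaa : (leftIdealPlus (B p q)).mkQ (x k * (a k * a k)) =
    -(leftIdealPlus (B p q)).mkQ (a k * (x k * a k))
      - (1 + q) • (leftIdealPlus (B p q)).mkQ (a k * a k)
      + (1 + q) • (leftIdealPlus (B p q)).mkQ 1 := by
  rw [xaa]
  simp only [map_add, map_sub, map_neg, mkQ_aax]
  module

theorem mkQ_axax : (leftIdealPlus (B p q)).mkQ (a k * (x k * (a k * x k))) =
    q • (leftIdealPlus (B p q)).mkQ (a k * (x k * a k))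
      + q • (leftIdealPlus (B p q)).mkQ (a k * (a k * (x k * a k)))
      + (q + q ^ 2) • (leftIdealPlus (B p q)).mkQ 1
      - (q + q ^ 2) • (leftIdealPlus (B p q)).mkQ (a k) := by
  have h := mkQ_mul_x p q (a k * (x k * a k))
  simp only [mul_assoc, xaa, mul_add, mul_sub, mul_neg, mul_one, aaa, aaa_assoc, map_add,
    map_sub, map_neg, mkQ_x] at h
  rw [h]
  module

/-! #### The map `γ` -/

/-- The values of `γ` at the classes `[(xa)ˡ]`. -/
noncomputable def gammaVal : Fin 3 → A k
  | 0 => 1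
  | 1 => x k * a k
  -- The coproduct of (xa)² contains axa ⊗ x, whereas colinearity asks for [axa] ⊗ γ([x]) = [axa] ⊗
  -- (q - qa). The correction axa(X - q) contributes exactly the difference, and it lies in AB⁺, so
  -- γ remains a section.
  | 2 => (x k * a k) ^ 2 - a k * x k * a k * (x k + q • a k - algebraMap k (A k) q)

/-- The linear map `γ`, determined by `γ [aⁱ bʲ (xa)ˡ] = aⁱ bʲ γ [(xa)ˡ]`. -/
noncomputable def gamma : (A k ⧸ leftIdealPlus (B p q)) →ₗ[k] A k :=
  (quotientBasis p q).constr k fun (i, j, l) => a k ^ (i : ℕ) * b k ^ (j : ℕ) * gammaVal q l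

theorem gamma_monomial (i j : ℕ) (l : Fin 3) : gamma p q ((leftIdealPlus (B p q)).mkQ
    (a k ^ i * b k ^ j * (x k * a k) ^ (l : ℕ))) = a k ^ i * b k ^ j * gammaVal q l := by
  rw [← a_pow_mod i, ← b_pow_mod j]
  have h := (quotientBasis p q).constr_basis k
    (fun (i, j, l) => a k ^ (i : ℕ) * b k ^ (j : ℕ) * gammaVal q l)
    ((⟨i % 3, Nat.mod_lt _ (by norm_num)⟩, ⟨j % 2, Nat.mod_lt _ (by norm_num)⟩, l) :
      Fin 3 × Fin 2 × Fin 3)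
  rw [quotientBasis_apply] at h
  exact h

theorem group_mul_monomial (i j i' j' : ℕ) (z : A k) :
    a k ^ i * b k ^ j * (a k ^ i' * b k ^ j' * z) = a k ^ (i + i') * b k ^ (j + j') * z := by
  have h : b k ^ j * a k ^ i' = a k ^ i' * b k ^ j := (commute_ab (k := k).pow_pow i' j).eq.symm
  rw [pow_add, pow_add]
  simp only [← mul_assoc]
  rw [mul_assoc _ (b k ^ j), h, ← mul_assoc]

/-- This extends the defining formula of γ from monomials to all z, using that A is the right B-span
of the monomials; later checks then reduce to i = j = 0. -/
theorem gamma_group_mul (i j : ℕ) (z : A k) :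
    gamma p q ((leftIdealPlus (B p q)).mkQ (a k ^ i * b k ^ j * z)) =
      a k ^ i * b k ^ j * gamma p q ((leftIdealPlus (B p q)).mkQ z) := by
  have hz : z ∈ rightSpan p q := by rw [rightSpan_eq_top]; trivial
  refine rightSpan_induction (P := fun z => gamma p q ((leftIdealPlus (B p q)).mkQ
    (a k ^ i * b k ^ j * z)) = a k ^ i * b k ^ j * gamma p q ((leftIdealPlus (B p q)).mkQ z))
    ?_ ?_ ?_ ?_ hz
  · intro i' j' l v hv
    rw [← mul_assoc, mkQ_mul_of_mem _ hv, mkQ_mul_of_mem _ hv, map_smul, map_smul,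
      group_mul_monomial, gamma_monomial, gamma_monomial, mul_smul_comm, group_mul_monomial]
  · simp
  · intro z w hz hw
    simp only [mul_add, map_add, hz, hw]
  · intro r z hz
    simp only [mul_smul_comm, map_smul, hz]

theorem gamma_one : gamma p q ((leftIdealPlus (B p q)).mkQ 1) = 1 := by
  simpa [gammaVal] using gamma_monomial p q 0 0 0

theorem gamma_xa : gamma p q ((leftIdealPlus (B p q)).mkQ (x k * a k)) = x k * a k := by
  simpa [gammaVal] using gamma_monomial p q 0 0 1

theorem gamma_xaxa : gamma p q ((leftIdealPlus (B p q)).mkQ (x k * (a k * (x k * a k)))) =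
    x k * (a k * (x k * a k)) - a k * (x k * (a k * x k)) - q • (a k * (x k * (a k * a k)))
      + q • (a k * (x k * a k)) := by
  have h := gamma_monomial p q 0 0 2
  simp only [pow_zero, one_mul, gammaVal, Fin.val_two, pow_two, mul_assoc, mul_add, mul_sub,
    mul_smul_comm, ← Algebra.commutes q, ← Algebra.smul_def] at h
  rw [h]
  module

theorem gamma_a_mul (z : A k) : gamma p q ((leftIdealPlus (B p q)).mkQ (a k * z)) =
    a k * gamma p q ((leftIdealPlus (B p q)).mkQ z) := by
  simpa using gamma_group_mul p q 1 0 z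

theorem gamma_a : gamma p q ((leftIdealPlus (B p q)).mkQ (a k)) = a k := by
  simpa [gammaVal] using gamma_monomial p q 1 0 0

theorem mkQ_gammaVal (l : Fin 3) : (leftIdealPlus (B p q)).mkQ (gammaVal q l) =
    (leftIdealPlus (B p q)).mkQ ((x k * a k) ^ (l : ℕ)) := by
  fin_cases l
  · simp [gammaVal]
  · simp [gammaVal]
  · change (leftIdealPlus (B p q)).mkQ (_ - _) = (leftIdealPlus (B p q)).mkQ ((x k * a k) ^ 2)
    have h := mkQ_mul_of_mem (a k * x k * a k)
      (sub_mem (X_mem p q) ((B p q).algebraMap_mem q))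
    rw [map_sub, counit_X, Bialgebra.counit_algebraMap, sub_self, zero_smul] at h
    rw [map_sub, sub_eq_self]
    exact h

theorem mkQ_comp_gamma : (leftIdealPlus (B p q)).mkQ ∘ₗ gamma p q = LinearMap.id := by
  refine (quotientBasis p q).ext fun (i, j, l) => ?_
  rw [LinearMap.comp_apply, LinearMap.id_apply, quotientBasis_apply, gamma_monomial]
  exact mkQ_mul_congr _ (mkQ_gammaVal p q l)

/-! #### The convolution inverse of `γ` -/

/-- The values of the convolution inverse of `γ` at the classes `[(xa)ˡ]`. -/
noncomputable def deltaVal : Fin 3 → A k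
  | 0 => 1
  -- Both nontrivial values solve δ * γ = ε: the coproducts of xa and (xa)² contain xa ⊗ a² and
  -- (xa)² ⊗ a, and a is invertible, so each value is determined by the preceding ones.
  | 1 => -(a k * (a k * (x k * (a k * a k))))
  | 2 => (1 + q) • x k - (3 + q) • (a k * (a k * x k)) - (3 : k) • (a k * (a k * (x k * x k)))
      - (2 : k) • (a k * (x k * (a k * x k))) + x k * (a k * (x k * a k))

/-- The convolution inverse of `γ`. -/
noncomputable def delta : (A k ⧸ leftIdealPlus (B p q)) →ₗ[k] A k :=
  (quotientBasis p q).constr k fun (i, j, l) =>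
    -- The factor on the right is the inverse of aⁱbʲ, since a³ = b² = 1.
    deltaVal q l * (b k ^ (j : ℕ) * (a k ^ (i : ℕ)) ^ 2)

theorem delta_monomial (i j : ℕ) (l : Fin 3) : delta p q ((leftIdealPlus (B p q)).mkQ
    (a k ^ i * b k ^ j * (x k * a k) ^ (l : ℕ))) =
      deltaVal q l * (b k ^ j * (a k ^ i) ^ 2) := by
  rw [← a_pow_mod i, ← b_pow_mod j]
  have h := (quotientBasis p q).constr_basis k
    (fun (i, j, l) => deltaVal q l * (b k ^ (j : ℕ) * (a k ^ (i : ℕ)) ^ 2))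
    ((⟨i % 3, Nat.mod_lt _ (by norm_num)⟩, ⟨j % 2, Nat.mod_lt _ (by norm_num)⟩, l) :
      Fin 3 × Fin 2 × Fin 3)
  rw [quotientBasis_apply] at h
  exact h

theorem delta_group_mul (i j : ℕ) (z : A k) :
    delta p q ((leftIdealPlus (B p q)).mkQ (a k ^ i * b k ^ j * z)) =
      delta p q ((leftIdealPlus (B p q)).mkQ z) * (b k ^ j * (a k ^ i) ^ 2) := by
  have hz : z ∈ rightSpan p q := by rw [rightSpan_eq_top]; trivial
  refine rightSpan_induction (P := fun z => delta p q ((leftIdealPlus (B p q)).mkQ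
    (a k ^ i * b k ^ j * z)) = delta p q ((leftIdealPlus (B p q)).mkQ z) *
      (b k ^ j * (a k ^ i) ^ 2)) ?_ ?_ ?_ ?_ hz
  · intro i' j' l v hv
    rw [← mul_assoc, mkQ_mul_of_mem _ hv, mkQ_mul_of_mem _ hv, map_smul, map_smul,
      group_mul_monomial, delta_monomial, delta_monomial, smul_mul_assoc, mul_assoc]
    congr 2
    have h : Commute (a k ^ i') (b k ^ j) := commute_ab.pow_pow i' j
    have h' : b k ^ j * (a k ^ i') ^ 2 = (a k ^ i') ^ 2 * b k ^ j := (h.pow_left 2).eq.symm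
    rw [mul_assoc (b k ^ j'), ← mul_assoc _ (b k ^ j), ← h', add_comm i, add_comm j, pow_add,
      pow_add, ((Commute.refl (a k)).pow_pow i' i).mul_pow]
    simp only [mul_assoc]
  · simp
  · intro z w hz hw
    simp only [mul_add, add_mul, map_add, hz, hw]
  · intro r z hz
    simp only [mul_smul_comm, smul_mul_assoc, map_smul, hz]

theorem delta_one : delta p q ((leftIdealPlus (B p q)).mkQ 1) = 1 := by
  simpa [deltaVal] using delta_monomial p q 0 0 0

theorem delta_xa : delta p q ((leftIdealPlus (B p q)).mkQ (x k * a k)) =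
    -(a k * (a k * (x k * (a k * a k)))) := by
  simpa [deltaVal] using delta_monomial p q 0 0 1

theorem delta_xaxa : delta p q ((leftIdealPlus (B p q)).mkQ (x k * (a k * (x k * a k)))) =
    (1 + q) • x k - (3 + q) • (a k * (a k * x k)) - (3 : k) • (a k * (a k * (x k * x k)))
      - (2 : k) • (a k * (x k * (a k * x k))) + x k * (a k * (x k * a k)) := by
  have h := delta_monomial p q 0 0 2
  simp only [pow_zero, one_pow, one_mul, mul_one, deltaVal, Fin.val_two, pow_two,
    mul_assoc] at h
  exact h

theorem delta_a_mul (z : A k) : delta p q ((leftIdealPlus (B p q)).mkQ (a k * z)) =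
    delta p q ((leftIdealPlus (B p q)).mkQ z) * (a k * a k) := by
  simpa [pow_two] using delta_group_mul p q 1 0 z

theorem delta_a : delta p q ((leftIdealPlus (B p q)).mkQ (a k)) = a k * a k := by
  have h := delta_a_mul p q 1
  rwa [mul_one, delta_one, one_mul] at h

/-! #### Colinearity -/

theorem leftCoaction_gammaVal (l : Fin 3) : leftCoaction (B p q) (gammaVal q l) =
    (gamma p q).lTensor _ (TensorProduct.map (leftIdealPlus (B p q)).mkQ
      (leftIdealPlus (B p q)).mkQ (comul ((x k * a k) ^ (l : ℕ)))) := by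
  rw [leftCoaction, LinearMap.comp_apply]
  fin_cases l
  · simp only [gammaVal, Fin.zero_eta, Fin.val_zero, pow_zero, Bialgebra.comul_one,
      Algebra.TensorProduct.one_def, TensorProduct.map_tmul, LinearMap.rTensor_tmul,
      LinearMap.lTensor_tmul, gamma_one]
  · simp only [gammaVal, Fin.mk_one, Fin.val_one, pow_one, comul_xa, map_add,
      TensorProduct.map_tmul, LinearMap.rTensor_tmul, LinearMap.lTensor_tmul, gamma_xa,
      gamma_a_mul, gamma_a]
  · change LinearMap.rTensor _ _ (comul (gammaVal q 2)) = LinearMap.lTensor _ _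
      (TensorProduct.map _ _ (comul ((x k * a k) ^ 2)))
    have h : gammaVal q 2 = (x k * a k) ^ 2 - a k * (x k * a k) * x k
        - q • (a k * (x k * a k) * a k) + q • (a k * (x k * a k)) := by
      simp only [gammaVal, mul_add, mul_sub, mul_smul_comm, ← Algebra.commutes q,
        ← Algebra.smul_def, mul_assoc]
      module
    rw [h]
    simp only [map_add, map_sub, map_smul, Bialgebra.comul_mul, comul_xa_sq, comul_a, comul_x]
    simp only [map_add, add_mul, mul_add, Algebra.TensorProduct.tmul_mul_tmul, mul_assoc,
      mul_one, one_mul, aaa, aaa_assoc, TensorProduct.map_tmul, LinearMap.rTensor_tmul, LinearMap.lTensor_tmul,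
      gamma_xaxa, gamma_xa, gamma_a_mul, gamma_a, gamma_one, mkQ_x, mkQ_aax, mkQ_xaa, mkQ_axax]
    simp only [xaa, mul_add, mul_sub, mul_neg, mul_one, aaa, aaa_assoc, map_add, map_sub,
      map_neg, mkQ_x, gamma_one, gamma_a, map_smul, TensorProduct.add_tmul,
      TensorProduct.sub_tmul, TensorProduct.neg_tmul, TensorProduct.tmul_add,
      TensorProduct.tmul_sub, TensorProduct.tmul_neg, TensorProduct.tmul_smul,
      ← TensorProduct.smul_tmul']
    module

theorem lTensor_gamma_group_mul (i j : ℕ) (t : A k ⊗[k] A k) :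
    (gamma p q).lTensor _ (TensorProduct.map (leftIdealPlus (B p q)).mkQ
      (leftIdealPlus (B p q)).mkQ ((a k ^ i * b k ^ j) ⊗ₜ (a k ^ i * b k ^ j) * t)) =
    TensorProduct.map (quotientMulLeft (B p q) (a k ^ i * b k ^ j))
      (LinearMap.mulLeft k (a k ^ i * b k ^ j)) ((gamma p q).lTensor _
        (TensorProduct.map (leftIdealPlus (B p q)).mkQ (leftIdealPlus (B p q)).mkQ t)) := by
  induction t with
  | zero => simp
  | add t₁ t₂ h₁ h₂ => simp only [mul_add, map_add, h₁, h₂]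
  | tmul t₁ t₂ =>
    simp only [Algebra.TensorProduct.tmul_mul_tmul, TensorProduct.map_tmul,
      LinearMap.lTensor_tmul, gamma_group_mul, quotientMulLeft_mkQ, LinearMap.mulLeft_apply]

/-- The group-like factor aⁱbʲ acts diagonally on both sides, leaving only the powers of xa treated
in `leftCoaction_gammaVal`. -/
theorem gamma_colinear : leftCoaction (B p q) ∘ₗ gamma p q =
    (gamma p q).lTensor (A k ⧸ leftIdealPlus (B p q)) ∘ₗ comul := by
  refine (quotientBasis p q).ext fun (i, j, l) => ?_
  rw [LinearMap.comp_apply, LinearMap.comp_apply, quotientBasis_apply, gamma_monomial]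
  change LinearMap.rTensor _ _ (comul _) = LinearMap.lTensor _ _ (TensorProduct.map _ _ (comul _))
  rw [Bialgebra.comul_mul, Bialgebra.comul_mul _ ((x k * a k) ^ (l : ℕ)), comul_group,
    lTensor_gamma_group_mul, rTensor_mkQ_tmul_mul, ← leftCoaction_gammaVal]
  rfl

/-! #### Convolution invertibility -/

theorem group_mul_inv (i j : ℕ) :
    a k ^ i * b k ^ j * (b k ^ j * (a k ^ i) ^ 2) = 1 := by
  rw [mul_assoc, ← mul_assoc (b k ^ j), ← pow_add, ← two_mul, pow_mul, pow_two (b k), bb,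
    one_pow, one_mul, ← pow_succ', ← pow_mul, mul_comm, pow_mul, relations.aaa, one_pow]

theorem inv_mul_group (i j : ℕ) :
    b k ^ j * (a k ^ i) ^ 2 * (a k ^ i * b k ^ j) = 1 := by
  rw [mul_assoc, ← mul_assoc _ (a k ^ i), ← pow_succ, ← pow_mul, mul_comm i, pow_mul,
    relations.aaa, one_pow, one_mul, ← pow_add, ← two_mul, pow_mul, pow_two (b k), bb, one_pow]

theorem delta_gamma_xa_pow (l : Fin 3) :
    LinearMap.mul' k (A k) (TensorProduct.map (delta p q) (gamma p q)
      (TensorProduct.map (leftIdealPlus (B p q)).mkQ (leftIdealPlus (B p q)).mkQ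
        (comul ((x k * a k) ^ (l : ℕ))))) =
      algebraMap k (A k) (counit (R := k) ((x k * a k) ^ (l : ℕ))) := by
  fin_cases l
  · simp only [Fin.zero_eta, Fin.val_zero, pow_zero, Bialgebra.comul_one,
      Bialgebra.counit_one, map_one, Algebra.TensorProduct.one_def, TensorProduct.map_tmul,
      gamma_one, delta_one, LinearMap.mul'_apply, mul_one]
  · simp only [Fin.mk_one, Fin.val_one, pow_one, comul_xa, map_add, TensorProduct.map_tmul,
      gamma_xa, gamma_a_mul, gamma_a, delta_xa, delta_a, LinearMap.mul'_apply,
      Bialgebra.counit_mul, counit_x, zero_mul, map_zero, neg_mul, mul_assoc, aaa, aaa_assoc,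
      mul_one]
    abel
  · change LinearMap.mul' k (A k) (TensorProduct.map _ _ (TensorProduct.map _ _ (comul
      ((x k * a k) ^ 2)))) = algebraMap k (A k) (counit (R := k) ((x k * a k) ^ 2))
    rw [comul_xa_sq]
    simp only [map_add, map_sub, map_neg, map_smul, TensorProduct.map_tmul, mkQ_x, mkQ_xaa,
      gamma_xaxa, gamma_xa, gamma_a_mul, gamma_a, gamma_one, delta_xaxa, delta_xa, delta_a_mul,
      delta_a, delta_one, LinearMap.mul'_apply,
      pow_two (x k * a k), Bialgebra.counit_mul, counit_x, zero_mul, map_zero]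
    simp only [neg_mul, mul_neg, mul_assoc, add_mul, mul_add, sub_mul, mul_sub, smul_mul_assoc,
      mul_smul_comm, smul_add, smul_sub, smul_neg, mul_one, one_mul, aaa, xaa, xxa, xxx,
      aaa_assoc, xaa_assoc, xxa_assoc, xxx_assoc]
    module

theorem gamma_delta_xa_pow (l : Fin 3) :
    LinearMap.mul' k (A k) (TensorProduct.map (gamma p q) (delta p q)
      (TensorProduct.map (leftIdealPlus (B p q)).mkQ (leftIdealPlus (B p q)).mkQ
        (comul ((x k * a k) ^ (l : ℕ))))) =
      algebraMap k (A k) (counit (R := k) ((x k * a k) ^ (l : ℕ))) := by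
  fin_cases l
  · simp only [Fin.zero_eta, Fin.val_zero, pow_zero, Bialgebra.comul_one,
      Bialgebra.counit_one, map_one, Algebra.TensorProduct.one_def, TensorProduct.map_tmul,
      gamma_one, delta_one, LinearMap.mul'_apply, mul_one]
  · simp only [Fin.mk_one, Fin.val_one, pow_one, comul_xa, map_add, TensorProduct.map_tmul,
      gamma_xa, gamma_a_mul, gamma_a, delta_xa, delta_a_mul, delta_a, LinearMap.mul'_apply,
      Bialgebra.counit_mul, counit_x, zero_mul, map_zero, mul_neg, mul_assoc, aaa, aaa_assoc,
      mul_one]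
    abel
  · change LinearMap.mul' k (A k) (TensorProduct.map _ _ (TensorProduct.map _ _ (comul
      ((x k * a k) ^ 2)))) = algebraMap k (A k) (counit (R := k) ((x k * a k) ^ 2))
    rw [comul_xa_sq]
    simp only [map_add, map_sub, map_neg, map_smul, TensorProduct.map_tmul, mkQ_x, mkQ_xaa,
      gamma_xaxa, gamma_xa, gamma_a_mul, gamma_a, gamma_one, delta_xaxa, delta_xa, delta_a_mul,
      delta_a, delta_one, LinearMap.mul'_apply,
      pow_two (x k * a k), Bialgebra.counit_mul, counit_x, zero_mul, map_zero]
    simp only [neg_mul, mul_neg, mul_assoc, add_mul, mul_add, sub_mul, mul_sub, smul_mul_assoc,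
      mul_smul_comm, smul_add, smul_sub, smul_neg, mul_one, one_mul, aaa, xaa, xxa, xxx,
      aaa_assoc, xaa_assoc, xxa_assoc, xxx_assoc]
    module

/-- With g = aⁱbʲ, the factors g⁻¹ and g meet in the middle of the product and cancel. -/
theorem delta_gamma_group_mul (i j : ℕ) (t : A k ⊗[k] A k) :
    LinearMap.mul' k (A k) (TensorProduct.map (delta p q) (gamma p q)
      (TensorProduct.map (leftIdealPlus (B p q)).mkQ (leftIdealPlus (B p q)).mkQ
        ((a k ^ i * b k ^ j) ⊗ₜ (a k ^ i * b k ^ j) * t))) =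
    LinearMap.mul' k (A k) (TensorProduct.map (delta p q) (gamma p q)
      (TensorProduct.map (leftIdealPlus (B p q)).mkQ (leftIdealPlus (B p q)).mkQ t)) := by
  induction t with
  | zero => simp
  | add t₁ t₂ h₁ h₂ => simp only [mul_add, map_add, h₁, h₂]
  | tmul t₁ t₂ =>
    simp only [Algebra.TensorProduct.tmul_mul_tmul, TensorProduct.map_tmul,
      gamma_group_mul, delta_group_mul, LinearMap.mul'_apply]
    rw [mul_assoc, ← mul_assoc (b k ^ j * (a k ^ i) ^ 2), inv_mul_group, one_mul]

/-- In this order g and g⁻¹ end up outside, so the value is conjugated by g; this is harmless once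
the inner value is a scalar. -/
theorem gamma_delta_group_mul (i j : ℕ) (t : A k ⊗[k] A k) :
    LinearMap.mul' k (A k) (TensorProduct.map (gamma p q) (delta p q)
      (TensorProduct.map (leftIdealPlus (B p q)).mkQ (leftIdealPlus (B p q)).mkQ
        ((a k ^ i * b k ^ j) ⊗ₜ (a k ^ i * b k ^ j) * t))) =
    a k ^ i * b k ^ j * LinearMap.mul' k (A k) (TensorProduct.map (gamma p q) (delta p q)
      (TensorProduct.map (leftIdealPlus (B p q)).mkQ (leftIdealPlus (B p q)).mkQ t)) *
      (b k ^ j * (a k ^ i) ^ 2) := by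
  induction t with
  | zero => simp
  | add t₁ t₂ h₁ h₂ => simp only [mul_add, add_mul, map_add, h₁, h₂]
  | tmul t₁ t₂ =>
    simp only [Algebra.TensorProduct.tmul_mul_tmul, TensorProduct.map_tmul,
      gamma_group_mul, delta_group_mul, LinearMap.mul'_apply]
    simp only [mul_assoc]

theorem delta_convMul_gamma :
    WithConv.toConv (delta p q) * WithConv.toConv (gamma p q) = 1 := by
  refine WithConv.ofConv_injective ((quotientBasis p q).ext fun (i, j, l) => ?_)
  rw [quotientBasis_apply]
  change LinearMap.mul' k (A k) (TensorProduct.map (delta p q) (gamma p q)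
    (TensorProduct.map _ _ (comul _))) =
    algebraMap k (A k) (counit (R := k) (a k ^ (i : ℕ) * b k ^ (j : ℕ) * (x k * a k) ^ (l : ℕ)))
  rw [Bialgebra.comul_mul _ ((x k * a k) ^ (l : ℕ)), comul_group, delta_gamma_group_mul,
    delta_gamma_xa_pow, counit_group_mul]

theorem gamma_convMul_delta :
    WithConv.toConv (gamma p q) * WithConv.toConv (delta p q) = 1 := by
  refine WithConv.ofConv_injective ((quotientBasis p q).ext fun (i, j, l) => ?_)
  rw [quotientBasis_apply]
  change LinearMap.mul' k (A k) (TensorProduct.map (gamma p q) (delta p q)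
    (TensorProduct.map _ _ (comul _))) =
    algebraMap k (A k) (counit (R := k) (a k ^ (i : ℕ) * b k ^ (j : ℕ) * (x k * a k) ^ (l : ℕ)))
  rw [Bialgebra.comul_mul _ ((x k * a k) ^ (l : ℕ)), comul_group, gamma_delta_group_mul,
    gamma_delta_xa_pow, counit_group_mul, ← Algebra.commutes, mul_assoc, group_mul_inv, mul_one]

theorem isCleavingMap_gamma : IsCleavingMap (B p q) (gamma p q) where
  colinear := gamma_colinear p q
  convolution_invertible :=
    ⟨⟨_, _, gamma_convMul_delta p q, delta_convMul_gamma p q⟩, rfl⟩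

/-- The image of `γ` generates `A` as a right `B`-module. -/
theorem span_gamma_mul :
    Submodule.span k {z : A k | ∃ u, ∃ v ∈ B p q, z = gamma p q u * v} = ⊤ := by
  rw [eq_top_iff, ← rightSpan_eq_top (p := p) (q := q)]
  refine Submodule.span_le.2 ?_
  rintro _ ⟨i, j, l, v, hv, rfl⟩
  have h : ∀ (i j : ℕ) (l : Fin 3), ∀ v ∈ B p q, a k ^ i * b k ^ j * gammaVal q l * v ∈
      Submodule.span k {z : A k | ∃ u, ∃ v ∈ B p q, z = gamma p q u * v} :=
    fun i j l v hv => Submodule.subset_span ⟨_, v, hv, by rw [gamma_monomial]⟩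
  fin_cases l
  · simpa [gammaVal] using h i j 0 v hv
  · simpa [gammaVal] using h i j 1 v hv
  -- The passage from the γ-values to the monomials is triangular over B: (xa)² is the third γ-value
  -- plus a(xa)(X - q), with X - q in B.
  · have e : a k ^ i * b k ^ j * (x k * a k) ^ 2 * v =
        a k ^ i * b k ^ j * gammaVal q 2 * v + a k ^ (i + 1) * b k ^ j * gammaVal q 1 *
          ((X q - algebraMap k (A k) q) * v) := by
      have hc : a k ^ (i + 1) * b k ^ j = a k ^ i * b k ^ j * a k := by
        rw [pow_succ, mul_assoc, (commute_ab (k := k).pow_right j).eq, mul_assoc]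
      rw [hc]
      simp only [gammaVal, X, mul_sub, sub_mul, mul_assoc]
      abel
    change a k ^ i * b k ^ j * (x k * a k) ^ 2 * v ∈ _
    rw [e]
    exact add_mem (h i j 2 v hv) (h (i + 1) j 1 _
      (mul_mem (sub_mem (X_mem p q) ((B p q).algebraMap_mem q)) hv))

end NodalCubic.A

open NodalCubic HopfCleft in
theorem mainTheorem3 {k : Type*} [Field k] (p q : k) (hpq : p ^ 2 = q ^ 2 + q ^ 3) :
    IsRightCoideal (B p q) ∧
    (∃ _ : (leftIdealPlus (B p q)).IsCoideal,
      (∃ e : Module.Basis (Fin 3 × Fin 2 × Fin 3) k (A k ⧸ leftIdealPlus (B p q)),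
        ∀ (i : Fin 3) (j : Fin 2) (l : Fin 3), e (i, j, l) = (leftIdealPlus (B p q)).mkQ
          (A.a k ^ (i : ℕ) * A.b k ^ (j : ℕ) * (A.x k * A.a k) ^ (l : ℕ))) ∧
      ∃ γ : (A k ⧸ leftIdealPlus (B p q)) →ₗ[k] A k,
        (∀ (i : Fin 3) (j : Fin 2),
          γ ((leftIdealPlus (B p q)).mkQ (A.a k ^ (i : ℕ) * A.b k ^ (j : ℕ))) =
              A.a k ^ (i : ℕ) * A.b k ^ (j : ℕ) ∧
          γ ((leftIdealPlus (B p q)).mkQ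
              (A.a k ^ (i : ℕ) * A.b k ^ (j : ℕ) * (A.x k * A.a k))) =
              A.a k ^ (i : ℕ) * A.b k ^ (j : ℕ) * (A.x k * A.a k) ∧
          γ ((leftIdealPlus (B p q)).mkQ
              (A.a k ^ (i : ℕ) * A.b k ^ (j : ℕ) * (A.x k * A.a k) ^ 2)) =
              A.a k ^ (i : ℕ) * A.b k ^ (j : ℕ) * ((A.x k * A.a k) ^ 2
                - A.a k * A.x k * A.a k * (A.x k + q • A.a k - algebraMap k (A k) q))) ∧
        (leftIdealPlus (B p q)).mkQ ∘ₗ γ = LinearMap.id ∧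
        IsCleavingMap (B p q) γ) ∧
    IsCleft (B p q) := by
  refine ⟨A.isRightCoideal_B p q, ⟨A.isCoideal_B p q, ⟨A.quotientBasis p q,
    A.quotientBasis_apply p q⟩, A.gamma p q, fun i j => ⟨?_, ?_, ?_⟩, A.mkQ_comp_gamma p q,
    A.isCleavingMap_gamma p q⟩, A.isRightCoideal_B p q, fun z => ⟨fun hz => ?_, fun hz => ?_⟩,
    A.isCoideal_B p q, A.gamma p q, A.isCleavingMap_gamma p q⟩
  · simpa [A.gammaVal] using A.gamma_monomial p q i j 0
  · simpa [A.gammaVal] using A.gamma_monomial p q i j 1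
  · exact A.gamma_monomial p q i j 2
  · exact leftCoaction_of_mem (A.isRightCoideal_B p q) hz
  · exact mem_of_coinvariant (A.isRightCoideal_B p q) (A.isCleavingMap_gamma p q)
      (A.gamma_one p q) (A.span_gamma_mul p q) hz
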